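/- Let $Y=\mathbb{R}$ and $\phi(y)=y^3/3$, or $Y=S^1=\mathbb{R}/2\pi\mathbb{Z}$ and $\phi(y)=\sin y$. For $h>0$ and $\xi\in\mathbb{R}$ let $$P_\xi = h\partial_y+\xi+\partial_y\phi$$ be the unbounded operator on $L^2(Y)$ with domain $\{u\in L^2(\mathbb{R}):\ (1+y^4)^{1/2}u\in L^2(\mathbb{R}),\ u'\in L^2(\mathbb{R})\}$ if $Y=\mathbb{R}$, and $H^1(S^1)$ if $Y=S^1$. The spectrum of $P_\xi^*P_\xi$ is purely discrete; let $0\le t_0(P_\xi)\le t_1(P_\xi)\le\dots\to+\infty$ be the singular values of $P_\xi$, i.e. the square roots of the eigenvalues of $P_\xi^*P_\xi$ counted with multiplicity. 1. Let $K$ be a compact ($h$-independent) subset of $]-\infty,0[$ if $Y=\mathbb{R}$, and of $]-1,1[$ if $Y=S^1$. There are constants $C>0$ and $h_0>0$ such that for all $h\in\,]0,h_0]$ and all $\xi\in K$ $$t_1(P_\xi)\ \ge\ \frac{h^{1/2}}{C}.$$ 2. Let $Y=\mathbb{R}$. For every $C_0>0$ there are $C>0$ and $h_0>0$ such that for all $h\in\,]0,h_0]$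 and all $\xi\in\mathbb{R}$ with $C_0h^{2/3}\le-\xi\le 1/C_0$ or $-\xi\ge C_0$ $$t_1(P_\xi)\ \ge\ \frac{h^{1/2}|\xi|^{1/4}}{C}.$$ 3. Let $Y=S^1$. For every $C_0>0$ there are $C>0$ and $h_0>0$ such that for all $h\in\,]0,h_0]$ and all $\xi\in\mathbb{R}$ with $C_0h^{2/3}\le 1+\xi\le 1/C_0$ or $C_0h^{2/3}\le 1-\xi\le 1/C_0$ $$t_1(P_\xi)\ \ge\ \frac{h^{1/2}\,\bigl|1-|\xi|\bigr|^{1/4}}{C}.$$ -/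

import Mathlib

open MeasureTheory Filter Set
open scoped ContDiff ENNReal

noncomputable section

namespace SmallSV

instance factTwoPiPos : Fact (0 < 2 * Real.pi) := ⟨Real.two_pi_pos⟩

/-- The circle `ℝ / 2πℤ`, with its Lebesgue measure `volume` of total mass `2π`. -/
abbrev Circ : Type := AddCircle (2 * Real.pi)

/-! ### Weak derivatives -/

/-- Test functions on a one-dimensional space `Y`: a set of pairs `(φ, φ')`, where `φ` is a test
function and `φ'` is its classical derivative. The two instances below are `C_c^∞(ℝ)` and
`C^∞(ℝ / 2πℤ)`. The two fields only record what makes weak derivatives in `L²` well defined. -/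
structure TestClass {Y : Type*} [MeasurableSpace Y] (μ : Measure Y) where
  pairs : Set ((Y → ℂ) × (Y → ℂ))
  memLp : ∀ p ∈ pairs, MemLp p.1 2 μ ∧ MemLp p.2 2 μ
  separating : ∀ v : Lp ℂ 2 μ, (∀ p ∈ pairs, ∫ y, v y * p.1 y ∂μ = 0) → v = 0

section Generic

variable {Y : Type*} [MeasurableSpace Y] {μ : Measure Y}

/-- `v` is the weak derivative of `u`: `∫ u φ' = - ∫ v φ` for all test functions `φ`. -/
def IsWeakDeriv (T : TestClass μ) (u v : Lp ℂ 2 μ) : Prop :=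
  ∀ p ∈ T.pairs, ∫ y, u y * p.2 y ∂μ = -∫ y, v y * p.1 y ∂μ

theorem integrable_mul_test (u : Lp ℂ 2 μ) {φ : Y → ℂ} (hφ : MemLp φ 2 μ) :
    Integrable (fun y => u y * φ y) μ :=
  MemLp.integrable_mul (Lp.memLp u) hφ

theorem integral_add_mul (u v : Lp ℂ 2 μ) {φ : Y → ℂ} (hφ : MemLp φ 2 μ) :
    ∫ y, (u + v : Lp ℂ 2 μ) y * φ y ∂μ = ∫ y, u y * φ y ∂μ + ∫ y, v y * φ y ∂μ := by
  rw [← integral_add (integrable_mul_test u hφ) (integrable_mul_test v hφ)]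
  refine integral_congr_ae ?_
  filter_upwards [Lp.coeFn_add u v] with y hy
  rw [hy, Pi.add_apply, add_mul]

theorem integral_smul_mul (c : ℂ) (u : Lp ℂ 2 μ) (φ : Y → ℂ) :
    ∫ y, (c • u : Lp ℂ 2 μ) y * φ y ∂μ = c * ∫ y, u y * φ y ∂μ := by
  rw [← integral_const_mul]
  refine integral_congr_ae ?_
  filter_upwards [Lp.coeFn_smul c u] with y hy
  rw [hy, Pi.smul_apply, smul_eq_mul, mul_assoc]

theorem IsWeakDeriv.add {T : TestClass μ} {u u' v v' : Lp ℂ 2 μ}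
    (h : IsWeakDeriv T u v) (h' : IsWeakDeriv T u' v') : IsWeakDeriv T (u + u') (v + v') := by
  intro p hp
  rw [integral_add_mul _ _ (T.memLp p hp).2, integral_add_mul _ _ (T.memLp p hp).1,
    h p hp, h' p hp]
  ring

theorem IsWeakDeriv.smul {T : TestClass μ} {u v : Lp ℂ 2 μ} (c : ℂ)
    (h : IsWeakDeriv T u v) : IsWeakDeriv T (c • u) (c • v) := by
  intro p hp
  rw [integral_smul_mul, integral_smul_mul, h p hp]
  ring

theorem IsWeakDeriv.unique {T : TestClass μ} {u v w : Lp ℂ 2 μ}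
    (h : IsWeakDeriv T u v) (h' : IsWeakDeriv T u w) : v = w := by
  have h1 : v + (-1 : ℂ) • w = 0 := by
    refine T.separating _ fun p hp => ?_
    rw [integral_add_mul _ _ (T.memLp p hp).1, integral_smul_mul]
    have := (h p hp).symm.trans (h' p hp)
    linear_combination -this
  rwa [neg_one_smul, add_neg_eq_zero] at h1

/-! ### The operators `h ∂_y + m(y)` -/

/-- The space of all `u ∈ L²` with weak derivative in `L²` and with `w u ∈ L²`. -/
def weightedH1 (T : TestClass μ) (w : Y → ℝ) : Submodule ℂ (Lp ℂ 2 μ) where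
  carrier := {u | MemLp (fun y => (w y : ℂ) * u y) 2 μ ∧ ∃ v : Lp ℂ 2 μ, IsWeakDeriv T u v}
  zero_mem' := by
    refine ⟨?_, 0, ?_⟩
    · refine (memLp_congr_ae ?_).2 (MemLp.zero' (ε := ℂ))
      filter_upwards [Lp.coeFn_zero ℂ 2 μ] with y hy
      rw [hy]; simp
    · have h0 : ∀ φ : Y → ℂ, ∫ y, (0 : Lp ℂ 2 μ) y * φ y ∂μ = 0 := fun φ => by
        simpa using integral_smul_mul (0 : ℂ) (0 : Lp ℂ 2 μ) φ
      intro p _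
      rw [h0, h0, neg_zero]
  add_mem' := by
    rintro u u' ⟨hu, v, hv⟩ ⟨hu', v', hv'⟩
    refine ⟨?_, v + v', hv.add hv'⟩
    refine (memLp_congr_ae ?_).2 (hu.add hu')
    filter_upwards [Lp.coeFn_add u u'] with y hy
    rw [hy, Pi.add_apply, Pi.add_apply, mul_add]
  smul_mem' := by
    rintro c u ⟨hu, v, hv⟩
    refine ⟨?_, c • v, hv.smul c⟩
    refine (memLp_congr_ae ?_).2 (hu.const_smul c)
    filter_upwards [Lp.coeFn_smul c u] with y hy
    simp only [hy, Pi.smul_apply, smul_eq_mul]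
    ring

/-- The weak derivative of an element of `weightedH1`. -/
def weakDeriv {T : TestClass μ} {w : Y → ℝ} (u : weightedH1 T w) : Lp ℂ 2 μ :=
  u.2.2.choose

theorem weakDeriv_spec {T : TestClass μ} {w : Y → ℝ} (u : weightedH1 T w) :
    IsWeakDeriv T u (weakDeriv u) :=
  u.2.2.choose_spec

theorem memLp_mul {T : TestClass μ} {w m : Y → ℝ} (hm : AEStronglyMeasurable m μ)
    (hmw : ∃ c : ℝ, ∀ y, |m y| ≤ c * w y) (u : weightedH1 T w) :
    MemLp (fun y => (m y : ℂ) * (u : Lp ℂ 2 μ) y) 2 μ := by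
  obtain ⟨c, hc⟩ := hmw
  refine MemLp.of_le_mul (c := |c|) u.2.1 ?_ (ae_of_all _ fun y => ?_)
  · exact (Complex.continuous_ofReal.comp_aestronglyMeasurable hm).mul
      (Lp.memLp (u : Lp ℂ 2 μ)).1
  · rw [norm_mul, norm_mul, ← mul_assoc, Complex.norm_real, Complex.norm_real,
      Real.norm_eq_abs, Real.norm_eq_abs, ← abs_mul]
    exact mul_le_mul_of_nonneg_right ((hc y).trans (le_abs_self _)) (norm_nonneg _)

/-- The unbounded operator `u ↦ h u' + m u` on `L²`, with domain `weightedH1 T w`. -/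
def firstOrderOp (T : TestClass μ) (w m : Y → ℝ) (hm : AEStronglyMeasurable m μ)
    (hmw : ∃ c : ℝ, ∀ y, |m y| ≤ c * w y) (h : ℝ) : Lp ℂ 2 μ →ₗ.[ℂ] Lp ℂ 2 μ where
  domain := weightedH1 T w
  toFun :=
    { toFun := fun u => (h : ℂ) • weakDeriv u + (memLp_mul hm hmw u).toLp
      map_add' := by
        intro u u'
        have h1 : weakDeriv (u + u') = weakDeriv u + weakDeriv u' :=
          (weakDeriv_spec (u + u')).unique ((weakDeriv_spec u).add (weakDeriv_spec u'))
        have h2 : (memLp_mul hm hmw (u + u')).toLp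
            = (memLp_mul hm hmw u).toLp + (memLp_mul hm hmw u').toLp := by
          rw [← MemLp.toLp_add]
          refine MemLp.toLp_congr _ _ ?_
          filter_upwards [Lp.coeFn_add (u : Lp ℂ 2 μ) u'] with y hy
          rw [Submodule.coe_add, hy, Pi.add_apply, Pi.add_apply, mul_add]
        rw [h1, h2, smul_add]
        abel
      map_smul' := by
        intro c u
        have h1 : weakDeriv (c • u) = c • weakDeriv u :=
          (weakDeriv_spec (c • u)).unique ((weakDeriv_spec u).smul c)
        have h2 : (memLp_mul hm hmw (c • u)).toLp = c • (memLp_mul hm hmw u).toLp := by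
          rw [← MemLp.toLp_const_smul]
          refine MemLp.toLp_congr _ _ ?_
          filter_upwards [Lp.coeFn_smul c (u : Lp ℂ 2 μ)] with y hy
          simp only [Submodule.coe_smul, hy, Pi.smul_apply, smul_eq_mul]
          ring
        rw [h1, h2, RingHom.id_apply, smul_add, smul_comm] }

end Generic

/-! ### The two model operators -/

/-- `C_c^∞(ℝ)`. -/
def lineTests : TestClass (volume : Measure ℝ) where
  pairs := {p | ContDiff ℝ ∞ p.1 ∧ HasCompactSupport p.1 ∧ p.2 = deriv p.1}
  memLp := by
    rintro ⟨φ, ψ⟩ ⟨h1, h2, h3⟩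
    dsimp only at h1 h2 h3 ⊢
    subst h3
    exact ⟨h1.continuous.memLp_of_hasCompactSupport h2,
      (h1.continuous_deriv (by simp)).memLp_of_hasCompactSupport h2.deriv⟩
  separating := by
    intro v hv
    have h0 : ∀ᵐ y ∂(volume : Measure ℝ), v y = 0 := by
      refine ae_eq_zero_of_integral_contDiff_smul_eq_zero
        ((Lp.memLp v).locallyIntegrable (by norm_num)) fun g hg hgc => ?_
      have := hv (fun y => (g y : ℂ), deriv fun y => (g y : ℂ))
        ⟨Complex.ofRealCLM.contDiff.comp hg, hgc.comp_left Complex.ofReal_zero, rfl⟩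
      simpa [mul_comm] using this
    exact (Lp.eq_zero_iff_ae_eq_zero).2 h0

/-- `C^∞(ℝ / 2πℤ)`: functions on the circle whose `2π`-periodic lift to `ℝ` is smooth. -/
def circTests : TestClass (volume : Measure Circ) where
  pairs := {p | ContDiff ℝ ∞ (fun y : ℝ => p.1 (y : Circ)) ∧
    ∀ y : ℝ, p.2 (y : Circ) = deriv (fun s : ℝ => p.1 (s : Circ)) y}
  memLp := by
    rintro ⟨φ, ψ⟩ ⟨h1, h2⟩
    dsimp only at h1 h2 ⊢
    have key : ∀ f : Circ → ℂ, Continuous (fun y : ℝ => f (y : Circ)) →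
        MemLp f 2 (volume : Measure Circ) := fun f hf => by
      have hc : Continuous f := isQuotientMap_quotient_mk'.continuous_iff.2 hf
      exact hc.memLp_of_hasCompactSupport (HasCompactSupport.of_compactSpace f)
    refine ⟨key φ h1.continuous, key ψ ?_⟩
    simp only [h2]
    exact h1.continuous_deriv (by simp)
  separating := by
    intro v hv
    have hv2 : MemLp (v : Circ → ℂ) 2 (AddCircle.haarAddCircle (T := 2 * Real.pi)) :=
      memLp_haarAddCircle_iff.2 (Lp.memLp v)
    have hcoef : ∀ n : ℤ, fourierCoeff (v : Circ → ℂ) n = 0 := by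
      intro n
      have hs : ContDiff ℝ ∞ (fun y : ℝ => fourier (T := 2 * Real.pi) (-n) (y : Circ)) := by
        simp only [fourier_coe_apply]
        exact Complex.contDiff_exp.comp
          ((contDiff_const.mul Complex.ofRealCLM.contDiff).div_const _)
      have hper : Function.Periodic
          (deriv fun s : ℝ => fourier (T := 2 * Real.pi) (-n) (s : Circ)) (2 * Real.pi) := by
        intro y
        rw [← deriv_comp_add_const]
        simp only [AddCircle.coe_add_period]
      have := hv (fourier (T := 2 * Real.pi) (-n), hper.lift) ⟨hs, fun y => hper.lift_coe y⟩
      rw [fourierCoeff, AddCircle.integral_haarAddCircle]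
      simp only [smul_eq_mul]
      rw [integral_congr_ae (ae_of_all _ fun y => mul_comm _ (v y)), this, smul_zero]
    have hz : hv2.toLp = 0 := by
      apply (fourierBasis (T := 2 * Real.pi)).repr.injective
      ext n
      rw [fourierBasis_repr, fourierCoeff_congr_ae hv2.coeFn_toLp, hcoef n, map_zero]
      rfl
    have hz' : ∀ᵐ y ∂(AddCircle.haarAddCircle (T := 2 * Real.pi)), v y = 0 := by
      filter_upwards [hv2.coeFn_toLp, Lp.eq_zero_iff_ae_eq_zero.1 hz] with y h1 h2
      rw [← h1, h2]; rfl
    refine Lp.eq_zero_iff_ae_eq_zero.2 ?_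
    have hz2 := Measure.ae_smul_measure hz' (ENNReal.ofReal (2 * Real.pi))
    rw [← AddCircle.volume_eq_smul_haarAddCircle] at hz2
    exact hz2

theorem line_bound (ξ : ℝ) : ∃ c : ℝ, ∀ y : ℝ, |ξ + y ^ 2| ≤ c * Real.sqrt (1 + y ^ 4) := by
  refine ⟨|ξ| + 1, fun y => (abs_add_le _ _).trans ?_⟩
  have h1 : (1 : ℝ) ≤ Real.sqrt (1 + y ^ 4) := Real.one_le_sqrt.2 (by nlinarith [sq_nonneg (y ^ 2)])
  have h2 : |y ^ 2| ≤ Real.sqrt (1 + y ^ 4) := Real.abs_le_sqrt (by nlinarith)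
  nlinarith [abs_nonneg ξ]

/-- `P_ξ = h ∂_y + ξ + ∂_y φ` on `L²(ℝ)` for `φ(y) = y³ / 3`, with domain
`{u ∈ L²(ℝ); (1 + y⁴)^{1/2} u ∈ L²(ℝ), u' ∈ L²(ℝ)}`. -/
def PLine (h ξ : ℝ) : Lp ℂ 2 (volume : Measure ℝ) →ₗ.[ℂ] Lp ℂ 2 (volume : Measure ℝ) :=
  firstOrderOp lineTests (fun y => Real.sqrt (1 + y ^ 4)) (fun y => ξ + y ^ 2)
    (by fun_prop) (line_bound ξ) h

/-- The cosine as a function on `ℝ / 2πℤ`. -/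
def circCos : Circ → ℝ := Real.cos_periodic.lift

theorem continuous_circCos : Continuous circCos :=
  isQuotientMap_quotient_mk'.continuous_iff.2 Real.continuous_cos

theorem circ_bound (ξ : ℝ) : ∃ c : ℝ, ∀ y : Circ, |ξ + circCos y| ≤ c * 1 := by
  refine ⟨|ξ| + 1, fun y => ?_⟩
  induction y using QuotientAddGroup.induction_on with
  | H y =>
    have h1 : circCos (y : Circ) = Real.cos y := Real.cos_periodic.lift_coe y
    have := abs_add_le ξ (Real.cos y)
    have := Real.abs_cos_le_one y
    rw [h1]
    linarith

/-- `P_ξ = h ∂_y + ξ + ∂_y φ` on `L²(ℝ / 2πℤ)` for `φ(y) = sin y`, with domain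
`H¹(ℝ / 2πℤ)`. -/
def PCirc (h ξ : ℝ) : Lp ℂ 2 (volume : Measure Circ) →ₗ.[ℂ] Lp ℂ 2 (volume : Measure Circ) :=
  firstOrderOp circTests (fun _ => 1) (fun y => ξ + circCos y)
    (continuous_const.add continuous_circCos).aestronglyMeasurable (circ_bound ξ) h

/-! ### Singular values -/

/-- `u` lies in the domain of `A* A` and `A* A u = l u`. -/
def IsEigenpair {H : Type*} [NormedAddCommGroup H] [InnerProductSpace ℂ H] [CompleteSpace H]
    (A : H →ₗ.[ℂ] H) (l : ℝ) (u : H) : Prop :=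
  ∃ (hu : u ∈ A.domain) (hAu : A ⟨u, hu⟩ ∈ A.adjoint.domain),
    A.adjoint ⟨A ⟨u, hu⟩, hAu⟩ = (l : ℂ) • u

/-- The spectrum of `A* A` is purely discrete, and `t 0 ≤ t 1 ≤ … → ∞` are the singular values of
`A`, i.e. the square roots of the eigenvalues of `A* A`, counted with multiplicity: there is a
Hilbert basis of eigenvectors of `A* A` with the eigenvalues `(t k)²`. -/
structure IsSingularValueSeq {H : Type*} [NormedAddCommGroup H] [InnerProductSpace ℂ H]
    [CompleteSpace H] (A : H →ₗ.[ℂ] H) (t : ℕ → ℝ) : Prop where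
  nonneg : ∀ k, 0 ≤ t k
  mono : Monotone t
  tendsto : Tendsto t atTop atTop
  basis : ∃ e : HilbertBasis ℕ ℂ H, ∀ k, IsEigenpair A (t k ^ 2) (e k)

end SmallSV

end

/-!
By the min-max principle, `t k ≥ κ` as soon as `‖P u‖ ≥ κ ‖u‖` for all `u` in a subspace of the
domain of codimension at most `k`; discreteness of the spectrum amounts to such a subspace for every
`κ`. Write `P = h ∂ + m` with `m = ξ + ∂φ`. Integrating `Re ⟨P u, w u⟩` by parts for a real weight
`w` gives

`∫ (m w - h w' / 2) |u|² + (h / 2) [w |u|²] ≤ sup |w| ‖P u‖ ‖u‖`.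

Cut `Y` at the zeros of `m` and take `w` of the sign of `m`. Where `m` changes sign from `-` to `+`,
that is, where the approximate kernel of `P` concentrates, the boundary terms have the wrong sign,
but they vanish on the subspace of codimension one of those `u` that vanish at this point. Near a
zero of `m` an exponentially decreasing `w` makes up for the smallness of `m`: if `|m|` grows with
slope `s` from its zeros, then `κ` is of order `√(h s)`, and here `s` is of order `|ξ|^{1/2}`,
respectively `|1 - |ξ||^{1/2}`. Vanishing at more points, as close to each other as `h / κ`, gives
coercivity with any `κ` on a subspace of finite codimension.
-/

noncomputable section

namespace SmallSV

section MinMax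

variable {H : Type*} [NormedAddCommGroup H] [InnerProductSpace ℂ H]

/-- `‖A u‖ ≥ κ ‖u‖` on a subspace of the domain of `A` of codimension at most `k`; the subspace is
given as the common kernel of `k` linear forms. -/
def CoerciveInCodim (A : H →ₗ.[ℂ] H) (κ : ℝ) (k : ℕ) : Prop :=
  ∃ L : A.domain →ₗ[ℂ] (Fin k → ℂ), ∀ u : A.domain, L u = 0 → κ * ‖(u : H)‖ ≤ ‖A u‖

theorem norm_sq_sum_smul_of_pairwise_orthogonal {ι : Type*} [Fintype ι] {v : ι → H}
    (hv : Pairwise fun i j => inner ℂ (v i) (v j) = 0) (c : ι → ℂ) :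
    ‖∑ i, c i • v i‖ ^ 2 = ∑ i, ‖c i‖ ^ 2 * ‖v i‖ ^ 2 := by
  have hinner : inner ℂ (∑ i, c i • v i) (∑ i, c i • v i)
      = ((∑ i, ‖c i‖ ^ 2 * ‖v i‖ ^ 2 : ℝ) : ℂ) := by
    rw [sum_inner]
    push_cast
    refine Finset.sum_congr rfl fun i _ => ?_
    rw [inner_sum, Finset.sum_eq_single_of_mem i (Finset.mem_univ i)
      fun j _ hj => by rw [inner_smul_left, inner_smul_right, hv hj.symm, mul_zero, mul_zero]]
    rw [inner_smul_left, inner_smul_right, inner_self_eq_norm_sq_to_K, ← mul_assoc,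
      Complex.conj_mul']
    rfl
  rw [← inner_self_eq_norm_sq (𝕜 := ℂ), hinner]
  exact Complex.ofReal_re _

variable [CompleteSpace H] {A : H →ₗ.[ℂ] H} {t : ℕ → ℝ}

theorem IsEigenpair.inner_apply (hA : Dense (A.domain : Set H)) {l : ℝ} {u : H}
    (hu : u ∈ A.domain) (h : IsEigenpair A l u) (y : A.domain) :
    inner ℂ (A ⟨u, hu⟩) (A y) = (l : ℂ) * inner ℂ u (y : H) := by
  obtain ⟨_, hAu, h⟩ := h
  have hadj := A.adjoint_isFormalAdjoint hA ⟨A ⟨u, hu⟩, hAu⟩ y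
  rw [h, inner_smul_left, Complex.conj_ofReal] at hadj
  exact hadj.symm

theorem IsEigenpair.norm_sq_apply (hA : Dense (A.domain : Set H)) {l : ℝ} {u : H}
    (hu : u ∈ A.domain) (h : IsEigenpair A l u) : ‖A ⟨u, hu⟩‖ ^ 2 = l * ‖u‖ ^ 2 := by
  have hre := congrArg Complex.re (h.inner_apply hA hu ⟨u, hu⟩)
  rw [Complex.re_ofReal_mul] at hre
  rw [← inner_self_eq_norm_sq (𝕜 := ℂ), ← inner_self_eq_norm_sq (𝕜 := ℂ)]
  exact hre

/-- One half of the min-max principle: `k` linear forms have a common zero on the span of `k + 1`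
eigenvectors, where `‖A u‖ ≤ t k ‖u‖`. -/
theorem CoerciveInCodim.le_of_isEigenpair {κ : ℝ} {k : ℕ} (h : CoerciveInCodim A κ k)
    (hA : Dense (A.domain : Set H)) {e : ℕ → H} (he : Orthonormal ℂ e)
    (heig : ∀ n, IsEigenpair A (t n ^ 2) (e n)) (ht : ∀ n, 0 ≤ t n) (hmono : Monotone t) :
    κ ≤ t k := by
  obtain ⟨L, hL⟩ := h
  let v : Fin (k + 1) → A.domain := fun i => ⟨e i, (heig i).1⟩
  have hker : LinearMap.ker (L ∘ₗ Fintype.linearCombination ℂ v) ≠ ⊥ :=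
    LinearMap.ker_ne_bot_of_finrank_lt (by simp)
  obtain ⟨c, hc, hc0⟩ := Submodule.exists_mem_ne_zero_of_ne_bot hker
  have hcoe : ((Fintype.linearCombination ℂ v c : A.domain) : H) =
      ∑ i : Fin (k + 1), c i • e i := by
    simp [Fintype.linearCombination_apply, v]
  have hAc : A (Fintype.linearCombination ℂ v c) = ∑ i, c i • A (v i) := by
    rw [Fintype.linearCombination_apply, ← LinearPMap.toFun_eq_coe, map_sum]
    simp
  have horth : Pairwise fun i j : Fin (k + 1) => inner ℂ (e i) (e j) = 0 :=
    fun i j hij => he.2 (Fin.val_injective.ne hij)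
  have hAorth : Pairwise fun i j => inner ℂ (A (v i)) (A (v j)) = 0 := fun i j hij => by
    change inner ℂ (A (v i)) (A (v j)) = 0
    rw [(heig i).inner_apply hA, horth hij, mul_zero]
  have hnorm := norm_sq_sum_smul_of_pairwise_orthogonal horth c
  have hAnorm := norm_sq_sum_smul_of_pairwise_orthogonal hAorth c
  rw [← hcoe] at hnorm
  rw [← hAc] at hAnorm
  set u := Fintype.linearCombination ℂ v c
  have hupper : ‖A u‖ ^ 2 ≤ (t k * ‖(u : H)‖) ^ 2 := by
    rw [hAnorm, mul_pow, hnorm, Finset.mul_sum]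
    refine Finset.sum_le_sum fun i _ => ?_
    rw [(heig i).norm_sq_apply hA, mul_left_comm]
    gcongr
    · exact ht _
    · exact hmono (Nat.lt_succ_iff.1 i.2)
  have hu : 0 < ‖(u : H)‖ := by
    rw [norm_pos_iff, hcoe]
    exact fun h0 => hc0 (funext (Fintype.linearIndependent_iff.1
      (he.linearIndependent.comp _ Fin.val_injective) c h0))
  exact le_of_mul_le_mul_right ((hL u hc).trans
    (abs_le_of_sq_le_sq' hupper (mul_nonneg (ht k) hu.le)).2) hu

theorem IsSingularValueSeq.le_of_coerciveInCodim (h : IsSingularValueSeq A t)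
    (hA : Dense (A.domain : Set H)) {κ : ℝ} {k : ℕ} (hco : CoerciveInCodim A κ k) : κ ≤ t k := by
  obtain ⟨e, he⟩ := h.basis
  exact hco.le_of_isEigenpair hA e.orthonormal he h.nonneg h.mono

end MinMax

section Compact

variable {V H : Type*} [NormedAddCommGroup V] [InnerProductSpace ℂ V]
  [NormedAddCommGroup H] [InnerProductSpace ℂ H]

theorem finiteDimensional_orthogonal_closure_ker {k : ℕ} (L : V →ₗ[ℂ] (Fin k → ℂ)) :
    FiniteDimensional ℂ ((LinearMap.ker L).topologicalClosureᗮ : Submodule ℂ V) := by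
  refine FiniteDimensional.of_injective
    (L ∘ₗ ((LinearMap.ker L).topologicalClosureᗮ : Submodule ℂ V).subtype) ?_
  rw [← LinearMap.ker_eq_bot, LinearMap.ker_eq_bot']
  intro x hx
  have hclosure : (x : V) ∈ (LinearMap.ker L).topologicalClosure :=
    Submodule.le_topologicalClosure _ hx
  exact Subtype.ext (inner_self_eq_zero.1 ((Submodule.mem_orthogonal _ _).1 x.2 _ hclosure))

theorem exists_isCompactOperator_norm_sub_le [CompleteSpace V] {J : V →L[ℂ] H} {k : ℕ}
    (L : V →ₗ[ℂ] (Fin k → ℂ)) {ε : ℝ} (hε : 0 ≤ ε) (hL : ∀ v, L v = 0 → ‖J v‖ ≤ ε * ‖v‖) :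
    ∃ K : V →L[ℂ] H, IsCompactOperator K ∧ ‖J - K‖ ≤ ε := by
  let W : Submodule ℂ V := (LinearMap.ker L).topologicalClosure
  have hWcl : IsClosed (W : Set V) := Submodule.isClosed_topologicalClosure _
  have : CompleteSpace W := hWcl.completeSpace_coe
  have hW : ∀ v ∈ W, ‖J v‖ ≤ ε * ‖v‖ := fun v hv =>
    closure_minimal (s := (LinearMap.ker L : Set V)) (t := {v : V | ‖J v‖ ≤ ε * ‖v‖})
      (fun v hv => hL v hv) (isClosed_le (by fun_prop) (by fun_prop)) hv
  have : FiniteDimensional ℂ Wᗮ := finiteDimensional_orthogonal_closure_ker L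
  refine ⟨J ∘L Wᗮ.subtypeL ∘L Wᗮ.orthogonalProjectionOnto, ?_, ?_⟩
  · have hP : IsCompactOperator Wᗮ.orthogonalProjectionOnto :=
      isCompactOperator_of_locallyCompactSpace_dom _
    exact hP.clm_comp (J ∘L Wᗮ.subtypeL)
  · refine ContinuousLinearMap.opNorm_le_bound _ hε fun v => ?_
    have hdiff : (J - J ∘L Wᗮ.subtypeL ∘L Wᗮ.orthogonalProjectionOnto) v
        = J (W.starProjection v) := by
      simp only [sub_apply, ContinuousLinearMap.comp_apply, ← map_sub]
      congr 1
      rw [sub_eq_iff_eq_add]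
      exact (W.starProjection_add_starProjection_orthogonal v).symm
    rw [hdiff]
    refine (hW _ (Submodule.starProjection_apply_mem W v)).trans ?_
    gcongr
    exact Submodule.norm_starProjection_apply_le W v

theorem isCompactOperator_of_small_in_finite_codim [CompleteSpace V] [CompleteSpace H]
    {J : V →L[ℂ] H}
    (hJ : ∀ ε : ℝ, 0 < ε → ∃ (k : ℕ) (L : V →ₗ[ℂ] (Fin k → ℂ)),
      ∀ v, L v = 0 → ‖J v‖ ≤ ε * ‖v‖) : IsCompactOperator J := by
  have happrox : ∀ n : ℕ, ∃ K : V →L[ℂ] H, IsCompactOperator K ∧ ‖J - K‖ ≤ 1 / (n + 1 : ℝ) := by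
    intro n
    obtain ⟨k, L, hL⟩ := hJ (1 / (n + 1 : ℝ)) (by positivity)
    exact exists_isCompactOperator_norm_sub_le L (by positivity) hL
  choose K hK hJK using happrox
  refine isCompactOperator_of_tendsto (l := atTop) (F := K) ?_ (Eventually.of_forall hK)
  rw [tendsto_iff_norm_sub_tendsto_zero]
  refine squeeze_zero (fun _ => norm_nonneg _) (fun n => ?_)
    tendsto_one_div_add_atTop_nhds_zero_nat
  rw [norm_sub_rev]
  exact hJK n

end Compact

section TopEigenvector

variable {H : Type*} [NormedAddCommGroup H] [InnerProductSpace ℂ H] {S : H →L[ℂ] H}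

/-- A unit eigenvector `e ∈ W` of `S` at which the Rayleigh quotient of `S` attains its maximum `μ`
over the subspace `W`, with `μ` positive. -/
structure IsTopEigenvector (S : H →L[ℂ] H) (W : Submodule ℂ H) (μ : ℝ) (e : H) : Prop where
  mem : e ∈ W
  norm_eq_one : ‖e‖ = 1
  pos : 0 < μ
  apply_eq : S e = (μ : ℂ) • e
  le : ∀ x ∈ W, (inner ℂ x (S x)).re ≤ μ * ‖x‖ ^ 2

theorem re_inner_apply_of_apply_eq_smul {μ : ℝ} {e : H} (he : S e = (μ : ℂ) • e) :
    (inner ℂ e (S e)).re = μ * ‖e‖ ^ 2 := by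
  rw [he, inner_smul_right, Complex.re_ofReal_mul]
  exact congrArg _ (inner_self_eq_norm_sq (𝕜 := ℂ) e)

theorem exists_unit_eigenvector_of_isCompactOperator [CompleteSpace H] [Nontrivial H]
    (hS : IsCompactOperator S) (hsymm : S.IsSymmetric) (hS0 : S ≠ 0) :
    ∃ (μ : ℝ) (e : H), ‖e‖ = 1 ∧ |μ| = ‖S‖ ∧ S e = (μ : ℂ) • e := by
  obtain ⟨z, hz, hzn⟩ := spectrum.exists_nnnorm_eq_spectralRadius S
  rw [S.spectralRadius_eq_nnnorm hsymm.isSelfAdjoint] at hzn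
  have hnorm : ‖z‖ = ‖S‖ := congrArg NNReal.toReal (ENNReal.coe_injective hzn)
  have hz0 : z ≠ 0 := norm_ne_zero_iff.1 (hnorm ▸ norm_ne_zero_iff.2 hS0)
  have hev : Module.End.HasEigenvalue (S : Module.End ℂ H) z :=
    (hS.hasEigenvalue_iff_mem_spectrum hz0).2 hz
  obtain ⟨μ, rfl⟩ := Complex.conj_eq_iff_real.1 (hsymm.conj_eigenvalue_eq_self hev)
  obtain ⟨v, hv⟩ := hev.exists_hasEigenvector
  refine ⟨μ, ((‖v‖⁻¹ : ℝ) : ℂ) • v, ?_, by rw [← hnorm, Complex.norm_real, Real.norm_eq_abs], ?_⟩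
  · rw [norm_smul, Complex.norm_real, norm_inv, norm_norm,
      inv_mul_cancel₀ (norm_ne_zero_iff.2 hv.2)]
  · have hSv : S v = (μ : ℂ) • v := hv.apply_eq_smul
    rw [map_smul, hSv, smul_comm]

theorem exists_isTopEigenvector_top [CompleteSpace H] [Nontrivial H] (hS : IsCompactOperator S)
    (hsymm : S.IsSymmetric) (hpos : ∀ x, x ≠ 0 → 0 < (inner ℂ x (S x)).re) :
    ∃ (μ : ℝ) (e : H), IsTopEigenvector S ⊤ μ e := by
  have hS0 : S ≠ 0 := by
    rintro rfl
    obtain ⟨x, hx⟩ := exists_ne (0 : H)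
    simpa using hpos x hx
  obtain ⟨μ, e, he, hμ, hSe⟩ := exists_unit_eigenvector_of_isCompactOperator hS hsymm hS0
  have hμ0 : 0 < μ := by
    simpa [re_inner_apply_of_apply_eq_smul hSe, he] using
      hpos e (norm_ne_zero_iff.1 (by rw [he]; exact one_ne_zero))
  refine ⟨μ, e, trivial, he, hμ0, hSe, fun x _ => ?_⟩
  rw [abs_of_pos hμ0] at hμ
  calc (inner ℂ x (S x)).re ≤ ‖inner ℂ x (S x)‖ := Complex.re_le_norm _
    _ ≤ ‖x‖ * ‖S x‖ := norm_inner_le_norm _ _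
    _ ≤ ‖x‖ * (‖S‖ * ‖x‖) := by gcongr; exact S.le_opNorm x
    _ = μ * ‖x‖ ^ 2 := by rw [hμ]; ring

theorem exists_isTopEigenvector [CompleteSpace H] (hS : IsCompactOperator S)
    (hsymm : S.IsSymmetric) (hpos : ∀ x, x ≠ 0 → 0 < (inner ℂ x (S x)).re) {W : Submodule ℂ H}
    (hWc : IsClosed (W : Set H)) (hinv : ∀ x ∈ W, S x ∈ W) (hW : W ≠ ⊥) :
    ∃ (μ : ℝ) (e : H), IsTopEigenvector S W μ e := by
  have : CompleteSpace W := hWc.completeSpace_coe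
  have : Nontrivial W := Submodule.nontrivial_iff_ne_bot.2 hW
  obtain ⟨μ, e, he⟩ := exists_isTopEigenvector_top (S := S.restrict hinv) (hS.restrict' hinv)
    (hsymm.restrict_invariant hinv) (fun x hx => hpos x (by simpa using hx))
  exact ⟨μ, e, e.2, he.norm_eq_one, he.pos, congrArg Subtype.val he.apply_eq,
    fun x hx => he.le ⟨x, hx⟩ trivial⟩

theorem exists_isTopEigenvector_orthogonal [CompleteSpace H] (hS : IsCompactOperator S)
    (hsymm : S.IsSymmetric) (hpos : ∀ x, x ≠ 0 → 0 < (inner ℂ x (S x)).re)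
    (hH : ¬ FiniteDimensional ℂ H) (F : Submodule ℂ H) [FiniteDimensional ℂ F]
    (hF : ∀ x ∈ F, S x ∈ F) : ∃ (μ : ℝ) (e : H), IsTopEigenvector S Fᗮ μ e := by
  have hne : Fᗮ ≠ ⊥ := fun hbot => by
    have htop : F = ⊤ := (Submodule.orthogonal_eq_bot_iff (K := F)).1 hbot
    exact hH (Module.finite_def.2 (htop ▸ Module.Finite.iff_fg.1 inferInstance))
  refine exists_isTopEigenvector hS hsymm hpos (Submodule.isClosed_orthogonal F) ?_ hne
  intro x hx
  rw [Submodule.mem_orthogonal] at hx ⊢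
  intro y hy
  rw [← hsymm.apply_clm y x]
  exact hx _ (hF y hy)

/-- Successive maximization: `G n` is the span of the first `n` eigenvectors. -/
theorem exists_flag_isTopEigenvector [CompleteSpace H] (hS : IsCompactOperator S)
    (hsymm : S.IsSymmetric) (hpos : ∀ x, x ≠ 0 → 0 < (inner ℂ x (S x)).re)
    (hH : ¬ FiniteDimensional ℂ H) :
    ∃ (G : ℕ → Submodule ℂ H) (μ : ℕ → ℝ) (e : ℕ → H), G 0 = ⊥ ∧
      (∀ n, G (n + 1) = G n ⊔ Submodule.span ℂ {e n}) ∧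
      ∀ n, IsTopEigenvector S (G n)ᗮ (μ n) (e n) := by
  have hstep : ∀ F : Submodule ℂ H, FiniteDimensional ℂ F → (∀ x ∈ F, S x ∈ F) →
      ∃ (μ : ℝ) (e : H), IsTopEigenvector S Fᗮ μ e := fun F _ hF =>
    exists_isTopEigenvector_orthogonal hS hsymm hpos hH F hF
  choose! M E hE using hstep
  let G (n : ℕ) : Submodule ℂ H := (fun F => F ⊔ Submodule.span ℂ {E F})^[n] ⊥
  have hsucc (n : ℕ) : G (n + 1) = G n ⊔ Submodule.span ℂ {E (G n)} :=
    Function.iterate_succ_apply' _ n ⊥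
  have hG (n : ℕ) : FiniteDimensional ℂ (G n) ∧ ∀ x ∈ G n, S x ∈ G n := by
    induction n with
    | zero => exact ⟨inferInstanceAs (FiniteDimensional ℂ ↥(⊥ : Submodule ℂ H)), by simp [G]⟩
    | succ n ih =>
      have := ih.1
      rw [hsucc]
      refine ⟨inferInstance, fun x hx => ?_⟩
      obtain ⟨y, hy, z, hz, rfl⟩ := Submodule.mem_sup.1 hx
      obtain ⟨c, rfl⟩ := Submodule.mem_span_singleton.1 hz
      rw [map_add, map_smul, (hE _ ih.1 ih.2).apply_eq, smul_smul]
      exact Submodule.add_mem_sup (ih.2 y hy)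
        (Submodule.smul_mem _ _ (Submodule.mem_span_singleton_self _))
  exact ⟨G, fun n => M (G n), fun n => E (G n), rfl, hsucc, fun n => hE _ (hG n).1 (hG n).2⟩

theorem exists_eigenvector_seq [CompleteSpace H] (hS : IsCompactOperator S)
    (hsymm : S.IsSymmetric) (hpos : ∀ x, x ≠ 0 → 0 < (inner ℂ x (S x)).re)
    (hH : ¬ FiniteDimensional ℂ H) :
    ∃ (μ : ℕ → ℝ) (e : ℕ → H), Orthonormal ℂ e ∧ Antitone μ ∧ (∀ n, 0 < μ n) ∧
      (∀ n, S (e n) = (μ n : ℂ) • e n) ∧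
      ∀ x, (∀ n, inner ℂ (e n) x = 0) → ∀ n, (inner ℂ x (S x)).re ≤ μ n * ‖x‖ ^ 2 := by
  obtain ⟨G, μ, e, hG0, hG, he⟩ := exists_flag_isTopEigenvector hS hsymm hpos hH
  have hmono : Monotone G := monotone_nat_of_le_succ fun n => by rw [hG]; exact le_sup_left
  have hmem : ∀ n, e n ∈ G (n + 1) := fun n => by
    rw [hG]; exact Submodule.mem_sup_right (Submodule.mem_span_singleton_self _)
  have hlt : ∀ i j, i < j → inner ℂ (e i) (e j) = 0 := fun i j hij =>
    (Submodule.mem_orthogonal _ _).1 (he j).mem _ (hmono (Nat.succ_le_of_lt hij) (hmem i))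
  refine ⟨μ, e, ⟨fun n => (he n).norm_eq_one, fun i j hij => ?_⟩,
    antitone_nat_of_succ_le fun n => ?_, fun n => (he n).pos, fun n => (he n).apply_eq,
    fun x hx n => (he n).le x ?_⟩
  · rcases lt_or_gt_of_ne hij with h | h
    · exact hlt i j h
    · exact inner_eq_zero_symm.1 (hlt j i h)
  · have hle := (he n).le _ (Submodule.orthogonal_le (hmono (Nat.le_succ n)) (he (n + 1)).mem)
    rwa [re_inner_apply_of_apply_eq_smul (he (n + 1)).apply_eq, (he (n + 1)).norm_eq_one, one_pow,
      mul_one, mul_one] at hle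
  · induction n with
    | zero => simp [hG0]
    | succ n ih =>
      rw [hG, ← Submodule.inf_orthogonal]
      exact ⟨ih, Submodule.mem_orthogonal_singleton_iff_inner_right.2 (hx n)⟩

end TopEigenvector

section Graph

variable {H : Type*} [NormedAddCommGroup H] [InnerProductSpace ℂ H]

/-- The graph of `A` as a subspace of the Hilbert space `H ⊕ H`, so that its norm is the graph
norm of `A`. -/
def hilbertGraph (A : H →ₗ.[ℂ] H) : Submodule ℂ (WithLp 2 (H × H)) :=
  A.graph.comap (WithLp.linearEquiv 2 ℂ (H × H)).toLinearMap

/-- The inclusion of the domain of `A`, with the graph norm, into `H`. -/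
def graphFst (A : H →ₗ.[ℂ] H) : hilbertGraph A →L[ℂ] H :=
  WithLp.fstL 2 ℂ H H ∘L (hilbertGraph A).subtypeL

theorem mem_hilbertGraph {A : H →ₗ.[ℂ] H} {v : WithLp 2 (H × H)} :
    v ∈ hilbertGraph A ↔ ∃ x : A.domain, (x : H) = v.fst ∧ A x = v.snd := by
  rw [hilbertGraph, Submodule.mem_comap, LinearPMap.mem_graph_iff]
  rfl

/-- The points of the graph of `A`, seen as elements of the domain of `A`. -/
def graphToDomain (A : H →ₗ.[ℂ] H) : hilbertGraph A →ₗ[ℂ] A.domain :=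
  (graphFst A).toLinearMap.codRestrict A.domain fun v => by
    obtain ⟨x, hx, -⟩ := mem_hilbertGraph.1 v.2
    exact (show (x : H) = graphFst A v from hx) ▸ x.2

variable {A : H →ₗ.[ℂ] H}

theorem isClosed_hilbertGraph (hA : A.IsClosed) :
    IsClosed (hilbertGraph A : Set (WithLp 2 (H × H))) :=
  IsClosed.preimage (WithLp.prod_continuous_ofLp 2 H H) hA

theorem coe_graphToDomain (v : hilbertGraph A) : (graphToDomain A v : H) = graphFst A v := rfl

theorem apply_graphToDomain (v : hilbertGraph A) :
    A (graphToDomain A v) = (v : WithLp 2 (H × H)).snd := by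
  obtain ⟨x, hx, hAx⟩ := mem_hilbertGraph.1 v.2
  rw [← hAx]
  exact congrArg A (Subtype.ext hx.symm)

theorem surjective_graphToDomain (A : H →ₗ.[ℂ] H) : Function.Surjective (graphToDomain A) :=
  fun x => ⟨⟨WithLp.toLp 2 ((x : H), A x), mem_hilbertGraph.2 ⟨x, rfl, rfl⟩⟩, rfl⟩

theorem norm_apply_graphToDomain_le (v : hilbertGraph A) : ‖A (graphToDomain A v)‖ ≤ ‖v‖ := by
  rw [apply_graphToDomain]
  exact WithLp.norm_snd_le _ (v : WithLp 2 (H × H))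

theorem inner_hilbertGraph (v w : hilbertGraph A) :
    inner ℂ v w = inner ℂ (graphFst A v) (graphFst A w)
      + inner ℂ (A (graphToDomain A v)) (A (graphToDomain A w)) := by
  rw [apply_graphToDomain, apply_graphToDomain]
  exact WithLp.prod_inner_apply _ _

theorem isCompactOperator_graphFst [CompleteSpace H] [CompleteSpace (hilbertGraph A)]
    (hco : ∀ κ, ∃ k, CoerciveInCodim A κ k) : IsCompactOperator (graphFst A) := by
  refine isCompactOperator_of_small_in_finite_codim fun ε hε => ?_
  obtain ⟨k, L, hL⟩ := hco ε⁻¹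
  refine ⟨k, L ∘ₗ graphToDomain A, fun v hv => ?_⟩
  have hle := (hL (graphToDomain A v) hv).trans (norm_apply_graphToDomain_le v)
  rwa [coe_graphToDomain, inv_mul_le_iff₀ hε] at hle

end Graph

section Resolvent

variable {H : Type*} [NormedAddCommGroup H] [InnerProductSpace ℂ H] [CompleteSpace H]
  {A : H →ₗ.[ℂ] H} [CompleteSpace (hilbertGraph A)]

variable (A) in
/-- The operator `(1 + A* A)⁻¹`, obtained from the inclusion `J` of the domain of `A`, with the
graph norm, as `J J*`. -/
def graphResolvent : H →L[ℂ] H := graphFst A ∘L (graphFst A).adjoint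

theorem isCompactOperator_graphResolvent (hco : ∀ κ, ∃ k, CoerciveInCodim A κ k) :
    IsCompactOperator (graphResolvent A) :=
  (isCompactOperator_graphFst hco).comp_clm (graphFst A).adjoint

theorem isSymmetric_graphResolvent : (graphResolvent A).IsSymmetric :=
  (ContinuousLinearMap.isPositive_self_comp_adjoint (graphFst A)).isSymmetric

theorem graphResolvent_mem_domain (x : H) : graphResolvent A x ∈ A.domain :=
  (graphToDomain A ((graphFst A).adjoint x)).2

/-- The weak form of `(1 + A* A) u = x`. -/
theorem inner_graphResolvent_add_inner (x : H) (y : A.domain) :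
    inner ℂ (graphResolvent A x) (y : H) +
      inner ℂ (A ⟨graphResolvent A x, graphResolvent_mem_domain x⟩) (A y)
      = inner ℂ x (y : H) := by
  obtain ⟨w, rfl⟩ := surjective_graphToDomain A y
  rw [coe_graphToDomain, ← ContinuousLinearMap.adjoint_inner_left (graphFst A) w x,
    inner_hilbertGraph]
  rfl

theorem inner_graphResolvent_self_pos (hA : Dense (A.domain : Set H)) {x : H} (hx : x ≠ 0) :
    0 < (inner ℂ x (graphResolvent A x)).re := by
  have hadj : (graphFst A).adjoint x ≠ 0 := fun h0 => hx <| by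
    refine hA.eq_zero_of_inner_left ℂ fun y hy => ?_
    obtain ⟨w, hw⟩ := surjective_graphToDomain A ⟨y, hy⟩
    have hwy : graphFst A w = y := congrArg Subtype.val hw
    rw [← hwy, ← ContinuousLinearMap.adjoint_inner_left, h0, inner_zero_left]
  have hsq : (inner ℂ x (graphResolvent A x)).re = ‖(graphFst A).adjoint x‖ ^ 2 := by
    rw [graphResolvent, ContinuousLinearMap.comp_apply, ← ContinuousLinearMap.adjoint_inner_left]
    exact inner_self_eq_norm_sq (𝕜 := ℂ) (E := hilbertGraph A) _
  rw [hsq]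
  positivity

theorem isEigenpair_of_graphResolvent_apply_eq (hA : Dense (A.domain : Set H)) {μ : ℝ} (hμ : μ ≠ 0)
    {e : H} (he : graphResolvent A e = (μ : ℂ) • e) : IsEigenpair A (μ⁻¹ - 1) e := by
  have hμC : (μ : ℂ) ≠ 0 := Complex.ofReal_ne_zero.2 hμ
  have hmem : e ∈ A.domain := (A.domain.smul_mem_iff hμC).1 (he ▸ graphResolvent_mem_domain e)
  have hweak : ∀ y : A.domain,
      inner ℂ (((μ⁻¹ - 1 : ℝ) : ℂ) • e) (y : H) = inner ℂ (A ⟨e, hmem⟩) (A y) := by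
    intro y
    have hres : (⟨graphResolvent A e, graphResolvent_mem_domain e⟩ : A.domain) =
        (μ : ℂ) • ⟨e, hmem⟩ :=
      Subtype.ext he
    have hform := inner_graphResolvent_add_inner e y
    rw [hres, he, LinearPMap.map_smul, inner_smul_left, inner_smul_left,
      Complex.conj_ofReal] at hform
    rw [inner_smul_left, Complex.conj_ofReal]
    push_cast
    field_simp
    linear_combination - hform
  have hAmem : A ⟨e, hmem⟩ ∈ A.adjoint.domain := A.mem_adjoint_domain_of_exists _ ⟨_, hweak⟩
  exact ⟨hmem, hAmem, A.adjoint_apply_eq hA ⟨_, hAmem⟩ hweak⟩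

end Resolvent

theorem orthogonal_span_eq_bot_of_tendsto_zero {H : Type*} [NormedAddCommGroup H]
    [InnerProductSpace ℂ H] {S : H →L[ℂ] H} (hpos : ∀ x, x ≠ 0 → 0 < (inner ℂ x (S x)).re)
    {e : ℕ → H} {μ : ℕ → ℝ}
    (hmax : ∀ x, (∀ n, inner ℂ (e n) x = 0) → ∀ n, (inner ℂ x (S x)).re ≤ μ n * ‖x‖ ^ 2)
    (hμ : Tendsto μ atTop (nhds 0)) : (Submodule.span ℂ (Set.range e))ᗮ = ⊥ := by
  rw [Submodule.eq_bot_iff]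
  intro x hx
  by_contra hx0
  have horth : ∀ n, inner ℂ (e n) x = 0 := fun n =>
    (Submodule.mem_orthogonal _ _).1 hx _ (Submodule.subset_span ⟨n, rfl⟩)
  have hle : (inner ℂ x (S x)).re ≤ 0 * ‖x‖ ^ 2 := ge_of_tendsto' (hμ.mul_const _) (hmax x horth)
  exact ((hpos x hx0).trans_le hle).ne' (zero_mul _)

theorem exists_isSingularValueSeq {H : Type*} [NormedAddCommGroup H] [InnerProductSpace ℂ H]
    [CompleteSpace H] {A : H →ₗ.[ℂ] H} (hH : ¬ FiniteDimensional ℂ H)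
    (hA : Dense (A.domain : Set H)) (hcl : A.IsClosed) (hco : ∀ κ, ∃ k, CoerciveInCodim A κ k) :
    ∃ t : ℕ → ℝ, IsSingularValueSeq A t := by
  have : CompleteSpace (hilbertGraph A) := (isClosed_hilbertGraph hcl).completeSpace_coe
  obtain ⟨μ, e, he, hanti, hμ, hSe, hmax⟩ :=
    exists_eigenvector_seq (isCompactOperator_graphResolvent hco) isSymmetric_graphResolvent
      (fun x hx => inner_graphResolvent_self_pos hA hx) hH
  have heig : ∀ n, IsEigenpair A ((μ n)⁻¹ - 1) (e n) := fun n =>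
    isEigenpair_of_graphResolvent_apply_eq hA (hμ n).ne' (hSe n)
  have hnonneg : ∀ n, 0 ≤ (μ n)⁻¹ - 1 := fun n => by
    have hsq := (heig n).norm_sq_apply hA (heig n).1
    rw [he.1, one_pow, mul_one] at hsq
    exact hsq ▸ sq_nonneg _
  let t : ℕ → ℝ := fun n => Real.sqrt ((μ n)⁻¹ - 1)
  have ht2 : ∀ n, t n ^ 2 = (μ n)⁻¹ - 1 := fun n => Real.sq_sqrt (hnonneg n)
  have ht0 : ∀ n, 0 ≤ t n := fun n => Real.sqrt_nonneg _
  have hmono : Monotone t := fun i j hij =>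
    Real.sqrt_le_sqrt (sub_le_sub_right (inv_anti₀ (hμ j) (hanti hij)) 1)
  have heig' : ∀ n, IsEigenpair A (t n ^ 2) (e n) := fun n => ht2 n ▸ heig n
  have htend : Tendsto t atTop atTop := tendsto_atTop_atTop.2 fun κ => by
    obtain ⟨k, hk⟩ := hco κ
    exact ⟨k, fun n hn => (hk.le_of_isEigenpair hA he heig' ht0 hmono).trans (hmono hn)⟩
  have hμ0 : Tendsto μ atTop (nhds 0) := by
    refine (tendsto_inv_atTop_zero.comp (tendsto_atTop_add_const_right _ 1
      ((tendsto_pow_atTop two_ne_zero).comp htend))).congr fun n => ?_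
    simp [ht2]
  refine ⟨t, ht0, hmono, htend, HilbertBasis.mkOfOrthogonalEqBot he
    (orthogonal_span_eq_bot_of_tendsto_zero (fun x hx => inner_graphResolvent_self_pos hA hx)
      hmax hμ0), fun k => ?_⟩
  rw [HilbertBasis.coe_mkOfOrthogonalEqBot]
  exact heig' k

/-! ### Locally absolutely continuous functions -/

/-- `U` is locally absolutely continuous on `ℝ` with derivative `G`. -/
structure IsPrimitive (U G : ℝ → ℂ) : Prop where
  intervalIntegrable : ∀ a b, IntervalIntegrable G volume a b
  sub_eq : ∀ a b, U b - U a = ∫ x in a..b, G x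

namespace IsPrimitive

variable {U V G K : ℝ → ℂ}

theorem eq_add_integral (hU : IsPrimitive U G) (a : ℝ) : U = fun x => U a + ∫ y in a..x, G y :=
  funext fun x => by rw [← hU.sub_eq a x, add_sub_cancel]

theorem integral (hG : ∀ a b, IntervalIntegrable G volume a b) :
    IsPrimitive (fun x => ∫ y in (0 : ℝ)..x, G y) G :=
  ⟨hG, fun a b => intervalIntegral.integral_interval_sub_left (hG 0 b) (hG 0 a)⟩

theorem of_hasDerivAt (hU : ∀ x, HasDerivAt U (G x) x) (hG : Continuous G) : IsPrimitive U G :=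
  ⟨fun a b => hG.intervalIntegrable a b, fun a b =>
    (intervalIntegral.integral_eq_sub_of_hasDerivAt (fun x _ => hU x)
      (hG.intervalIntegrable a b)).symm⟩

theorem continuous (hU : IsPrimitive U G) : Continuous U := by
  rw [hU.eq_add_integral 0]
  exact continuous_const.add (intervalIntegral.continuous_primitive hU.intervalIntegrable 0)

theorem conj (hU : IsPrimitive U G) :
    IsPrimitive (fun x => starRingEnd ℂ (U x)) (fun x => starRingEnd ℂ (G x)) where
  intervalIntegrable a b :=
    ⟨(Complex.conjCLE : ℂ →L[ℝ] ℂ).integrable_comp (hU.intervalIntegrable a b).1,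
      (Complex.conjCLE : ℂ →L[ℝ] ℂ).integrable_comp (hU.intervalIntegrable a b).2⟩
  sub_eq a b := by
    have := (Complex.conjCLE : ℂ →L[ℝ] ℂ).intervalIntegral_comp_comm (hU.intervalIntegrable a b)
    rw [← hU.sub_eq] at this
    simpa using this.symm

theorem reflect (hU : IsPrimitive U G) (c : ℝ) :
    IsPrimitive (fun x => U (c - x)) (fun x => -G (c - x)) where
  intervalIntegrable a b := by
    have := (hU.intervalIntegrable (c - a) (c - b)).comp_sub_left c
    simp only [sub_sub_cancel] at this
    exact this.neg
  sub_eq a b := by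
    rw [intervalIntegral.integral_neg, intervalIntegral.integral_comp_sub_left (fun x => G x) c,
      ← hU.sub_eq, neg_sub]

theorem intervalIntegrable_re (hU : IsPrimitive U G) (a b : ℝ) :
    IntervalIntegrable (fun x => (G x).re) volume a b :=
  ⟨Complex.reCLM.integrable_comp (hU.intervalIntegrable a b).1,
    Complex.reCLM.integrable_comp (hU.intervalIntegrable a b).2⟩

theorem intervalIntegrable_im (hU : IsPrimitive U G) (a b : ℝ) :
    IntervalIntegrable (fun x => (G x).im) volume a b :=
  ⟨Complex.imCLM.integrable_comp (hU.intervalIntegrable a b).1,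
    Complex.imCLM.integrable_comp (hU.intervalIntegrable a b).2⟩

theorem re_sub_eq (hU : IsPrimitive U G) (a b : ℝ) :
    (U b).re - (U a).re = ∫ x in a..b, (G x).re := by
  have := Complex.reCLM.intervalIntegral_comp_comm (hU.intervalIntegrable a b)
  simpa [← hU.sub_eq] using this.symm

theorem im_sub_eq (hU : IsPrimitive U G) (a b : ℝ) :
    (U b).im - (U a).im = ∫ x in a..b, (G x).im := by
  have := Complex.imCLM.intervalIntegral_comp_comm (hU.intervalIntegrable a b)
  simpa [← hU.sub_eq] using this.symm

theorem absolutelyContinuousOnInterval (hU : IsPrimitive U G) (a b : ℝ) :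
    AbsolutelyContinuousOnInterval U a b := by
  have hconst (c : ℂ) : AbsolutelyContinuousOnInterval (fun _ : ℝ => c) a b :=
    ((LipschitzWith.const c).lipschitzOnWith (s := uIcc a b)).absolutelyContinuousOnInterval
  have hre := ((hU.intervalIntegrable_re a b).absolutelyContinuousOnInterval_intervalIntegral
    (c := a) left_mem_uIcc).fun_smul (hconst 1)
  have him := ((hU.intervalIntegrable_im a b).absolutelyContinuousOnInterval_intervalIntegral
    (c := a) left_mem_uIcc).fun_smul (hconst Complex.I)
  refine (congrArg (AbsolutelyContinuousOnInterval · a b) (funext fun x => ?_)).mp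
    ((hre.fun_add him).fun_add (hconst (U a)))
  rw [← hU.re_sub_eq, ← hU.im_sub_eq]
  apply Complex.ext <;> simp

theorem locallyIntegrable (hU : IsPrimitive U G) : LocallyIntegrable G volume := fun x =>
  ⟨Icc (x - 1) (x + 1), Icc_mem_nhds (by linarith) (by linarith),
    (intervalIntegrable_iff_integrableOn_Icc_of_le (by linarith)).1
      (hU.intervalIntegrable (x - 1) (x + 1))⟩

theorem ae_hasDerivAt (hU : IsPrimitive U G) : ∀ᵐ x, HasDerivAt U (G x) x := by
  filter_upwards [LocallyIntegrable.ae_hasDerivAt_integral hU.locallyIntegrable] with x hx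
  rw [hU.eq_add_integral 0]
  simpa using (hx 0).const_add (U 0)

theorem mul (hU : IsPrimitive U G) (hV : IsPrimitive V K) :
    IsPrimitive (fun x => U x * V x) (fun x => G x * V x + U x * K x) := by
  have hint (a b : ℝ) : IntervalIntegrable (fun x => G x * V x + U x * K x) volume a b :=
    ((hU.intervalIntegrable a b).mul_continuousOn hV.continuous.continuousOn).add
      ((hV.intervalIntegrable a b).continuousOn_mul hU.continuous.continuousOn)
  refine ⟨hint, fun a b => ?_⟩
  have hW := IsPrimitive.integral hint
  have hac : AbsolutelyContinuousOnInterval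
      (fun x => U x * V x - ∫ y in (0 : ℝ)..x, (G y * V y + U y * K y)) a b :=
    ((hU.absolutelyContinuousOnInterval a b).fun_smul
      (hV.absolutelyContinuousOnInterval a b)).fun_sub (hW.absolutelyContinuousOnInterval a b)
  have hderiv : ∀ᵐ x, x ∈ uIcc a b → HasDerivAt
      (fun x => U x * V x - ∫ y in (0 : ℝ)..x, (G y * V y + U y * K y)) 0 x := by
    filter_upwards [hU.ae_hasDerivAt, hV.ae_hasDerivAt, hW.ae_hasDerivAt] with x hUx hVx hWx _
    exact ((hUx.fun_mul hVx).fun_sub hWx).congr_deriv (sub_self _)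
  obtain ⟨C, hC⟩ := hac.const_of_ae_hasDerivAt_zero hderiv
  rw [← hW.sub_eq a b]
  linear_combination hC b right_mem_uIcc - hC a left_mem_uIcc

end IsPrimitive

/-! ### Energy estimates for `h U' + m U` -/

theorem IsPrimitive.mul_norm_sq_sub_eq {U G : ℝ → ℂ} (hU : IsPrimitive U G) {w w' : ℝ → ℝ}
    (hw : ∀ x, HasDerivAt w (w' x) x) (hw' : Continuous w') (p q : ℝ) :
    w q * ‖U q‖ ^ 2 - w p * ‖U p‖ ^ 2 =
      ∫ x in p..q, (w' x * ‖U x‖ ^ 2 + 2 * w x * (G x * starRingEnd ℂ (U x)).re) := by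
  have hwP : IsPrimitive (fun x => (w x : ℂ)) (fun x => (w' x : ℂ)) :=
    .of_hasDerivAt (fun x => (hw x).ofReal_comp) (by fun_prop)
  have hprod := (hwP.mul (hU.mul hU.conj)).re_sub_eq p q
  simp only [Complex.mul_conj'] at hprod
  norm_cast at hprod
  rw [hprod]
  refine intervalIntegral.integral_congr fun x _ => ?_
  simp [pow_two]
  ring

section Energy

variable {U G : ℝ → ℂ} {m : ℝ → ℝ} {h κ N s p q : ℝ}

/-- The function `h U' + m U`, where `G` stands for `U'`. -/
def firstOrderFun (h : ℝ) (m : ℝ → ℝ) (U G : ℝ → ℂ) (x : ℝ) : ℂ :=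
  (h : ℂ) * G x + (m x : ℂ) * U x

/-- The failure at `x` of the inequality `κ ‖U‖² ≤ N ‖h U' + m U‖ ‖U‖`. If its integral is not
positive, the Cauchy-Schwarz inequality gives `κ ‖U‖ ≤ N ‖h U' + m U‖` in `L²`. -/
def coercivityDefect (h : ℝ) (m : ℝ → ℝ) (κ N : ℝ) (U G : ℝ → ℂ) (x : ℝ) : ℝ :=
  κ * ‖U x‖ ^ 2 - N * (‖firstOrderFun h m U G x‖ * ‖U x‖)

theorem coercivityDefect_anti {N' : ℝ} (hN : N ≤ N') (x : ℝ) :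
    coercivityDefect h m κ N' U G x ≤ coercivityDefect h m κ N U G x := by
  unfold coercivityDefect
  gcongr

namespace IsPrimitive

theorem intervalIntegrable_firstOrderFun (hU : IsPrimitive U G) (hm : Continuous m)
    (h p q : ℝ) : IntervalIntegrable (firstOrderFun h m U G) volume p q := by
  have := hU.continuous
  exact ((hU.intervalIntegrable p q).const_mul _).add
    (Continuous.intervalIntegrable (by fun_prop) p q)

theorem intervalIntegrable_coercivityDefect (hU : IsPrimitive U G) (hm : Continuous m)
    (h κ N p q : ℝ) : IntervalIntegrable (coercivityDefect h m κ N U G) volume p q := by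
  have := hU.continuous
  exact (Continuous.intervalIntegrable (by fun_prop) p q).sub
    (((hU.intervalIntegrable_firstOrderFun hm h p q).norm.mul_continuousOn
      hU.continuous.norm.continuousOn).const_mul N)

end IsPrimitive

theorem re_firstOrderFun_mul_conj (h : ℝ) (m : ℝ → ℝ) (U G : ℝ → ℂ) (x : ℝ) :
    (firstOrderFun h m U G x * starRingEnd ℂ (U x)).re =
      h * (G x * starRingEnd ℂ (U x)).re + m x * ‖U x‖ ^ 2 := by
  rw [firstOrderFun, add_mul, mul_assoc, mul_assoc, Complex.mul_conj', Complex.add_re,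
    Complex.re_ofReal_mul, Complex.re_ofReal_mul]
  norm_cast

theorem coercivityDefect_le {w w' x : ℝ} (hN : |w| ≤ N) (hκ : κ ≤ m x * w - h / 2 * w') :
    coercivityDefect h m κ N U G x ≤
      -(h / 2) * (w' * ‖U x‖ ^ 2 + 2 * w * (G x * starRingEnd ℂ (U x)).re) := by
  have hre : |(firstOrderFun h m U G x * starRingEnd ℂ (U x)).re| ≤
      ‖firstOrderFun h m U G x‖ * ‖U x‖ := by
    simpa using Complex.abs_re_le_norm (firstOrderFun h m U G x * starRingEnd ℂ (U x))
  have hpair : w * (firstOrderFun h m U G x * starRingEnd ℂ (U x)).re ≤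
      N * (‖firstOrderFun h m U G x‖ * ‖U x‖) := by
    refine (le_abs_self _).trans ?_
    rw [abs_mul]
    exact mul_le_mul hN hre (abs_nonneg _) ((abs_nonneg _).trans hN)
  have hgain := mul_le_mul_of_nonneg_right hκ (sq_nonneg ‖U x‖)
  rw [re_firstOrderFun_mul_conj] at hpair
  rw [coercivityDefect]
  linarith

namespace IsPrimitive

theorem intervalIntegrable_mul_norm_sq_add (hU : IsPrimitive U G) {w w' : ℝ → ℝ}
    (hw : Continuous w) (hw' : Continuous w') (p q : ℝ) : IntervalIntegrable
      (fun x => w' x * ‖U x‖ ^ 2 + 2 * w x * (G x * starRingEnd ℂ (U x)).re) volume p q := by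
  have hUc := hU.continuous
  have hGU := (hU.intervalIntegrable p q).mul_continuousOn hU.conj.continuous.continuousOn
  have hre : IntervalIntegrable (fun x => (G x * starRingEnd ℂ (U x)).re) volume p q :=
    ⟨Complex.reCLM.integrable_comp hGU.1, Complex.reCLM.integrable_comp hGU.2⟩
  exact (Continuous.intervalIntegrable (by fun_prop) p q).add
    (hre.continuousOn_mul (g := fun x => 2 * w x) (by fun_prop))

/-- The multiplier method: `h U' + m U` is paired with `w U`. -/
theorem integral_coercivityDefect_le (hU : IsPrimitive U G) (hm : Continuous m) (hpq : p ≤ q)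
    {w w' : ℝ → ℝ} (hw : ∀ x, HasDerivAt w (w' x) x) (hw' : Continuous w')
    (hN : ∀ x ∈ Icc p q, |w x| ≤ N) (hκ : ∀ x ∈ Icc p q, κ ≤ m x * w x - h / 2 * w' x) :
    ∫ x in p..q, coercivityDefect h m κ N U G x ≤
      h / 2 * (w p * ‖U p‖ ^ 2 - w q * ‖U q‖ ^ 2) := by
  have hwc : Continuous w := continuous_iff_continuousAt.2 fun x => (hw x).continuousAt
  refine (intervalIntegral.integral_mono_on hpq
    (hU.intervalIntegrable_coercivityDefect hm h κ N p q)
    ((hU.intervalIntegrable_mul_norm_sq_add hwc hw' p q).const_mul (-(h / 2)))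
    fun x hx => coercivityDefect_le (hN x hx) (hκ x hx)).trans_eq ?_
  rw [intervalIntegral.integral_const_mul, ← hU.mul_norm_sq_sub_eq hw hw']
  ring

theorem integral_coercivityDefect_le_of_le (hU : IsPrimitive U G) (hm : Continuous m)
    (hh : 0 ≤ h) (hpq : p ≤ q) (hκ : ∀ x ∈ Icc p q, κ ≤ m x) :
    ∫ x in p..q, coercivityDefect h m κ 1 U G x ≤ h / 2 * ‖U p‖ ^ 2 := by
  have hbound := hU.integral_coercivityDefect_le hm (h := h) hpq (w := fun _ => 1)
    (fun x => hasDerivAt_const x 1) continuous_const (fun x _ => abs_one.le)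
    (fun x hx => by simpa using hκ x hx)
  have : 0 ≤ h / 2 * ‖U q‖ ^ 2 := by positivity
  linarith

end IsPrimitive

/-! ### Vanishing at the points of a fine subdivision -/

theorem IsPrimitive.integral_coercivityDefect_nonpos_of_short (hU : IsPrimitive U G)
    (hm : Continuous m) {M : ℝ} (hM : 0 ≤ M) (hmM : ∀ x ∈ Icc p q, -M ≤ m x) (hpq : p < q)
    (hh : 0 ≤ h) (hlen : (q - p) * (κ + 3 * M) ≤ h) (hp : U p = 0) :
    ∫ x in p..q, coercivityDefect h m κ 3 U G x ≤ 0 := by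
  have hqp : 0 < q - p := sub_pos.2 hpq
  have hratio (x : ℝ) (hx : x ∈ Icc p q) : 0 ≤ (x - p) / (q - p) ∧ (x - p) / (q - p) ≤ 1 :=
    ⟨div_nonneg (sub_nonneg.2 hx.1) hqp.le, (div_le_one hqp).2 (by linarith [hx.2])⟩
  have hslope : κ + 3 * M ≤ h / 2 * (2 * (1 / (q - p))) := by
    rw [show h / 2 * (2 * (1 / (q - p))) = h / (q - p) by ring, le_div_iff₀ hqp]
    linarith
  have hbound := hU.integral_coercivityDefect_le hm (h := h) (κ := κ) (N := 3) hpq.le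
    (w := fun x => 3 - 2 * ((x - p) / (q - p)))
    (fun x => ((((hasDerivAt_id x).sub_const p).div_const (q - p)).const_mul 2).const_sub 3)
    continuous_const
    (fun x hx => by
      obtain ⟨_, _⟩ := hratio x hx
      rw [abs_le]; constructor <;> linarith)
    (fun x hx => by
      obtain ⟨hr, hr'⟩ := hratio x hx
      have : -(3 * M) ≤ m x * (3 - 2 * ((x - p) / (q - p))) := by
        nlinarith [mul_nonneg hM hr, hmM x hx]
      linarith)
  simp only [hp, norm_zero, div_self hqp.ne'] at hbound
  have : 0 ≤ h * ‖U q‖ ^ 2 := by positivity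
  linarith

theorem IsPrimitive.integral_coercivityDefect_nonpos_of_subdivision (hU : IsPrimitive U G)
    (hm : Continuous m) {M δ : ℝ} (hM : 0 ≤ M) (hδ : 0 < δ) (n : ℕ)
    (hmM : ∀ x ∈ Icc p (p + n * δ), -M ≤ m x) (hh : 0 ≤ h) (hlen : δ * (κ + 3 * M) ≤ h)
    (hzero : ∀ i < n, U (p + i * δ) = 0) :
    ∫ x in p..p + n * δ, coercivityDefect h m κ 3 U G x ≤ 0 := by
  induction n with
  | zero => simp
  | succ n ih =>
    have hle : p + n * δ ≤ p + (n + 1 : ℕ) * δ := by gcongr; exact n.le_succ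
    have hp : p ≤ p + n * δ := le_add_of_nonneg_right (by positivity)
    rw [← intervalIntegral.integral_add_adjacent_intervals
      (hU.intervalIntegrable_coercivityDefect hm h κ 3 p (p + n * δ))
      (hU.intervalIntegrable_coercivityDefect hm h κ 3 _ _)]
    refine add_nonpos (ih (fun x hx => hmM x ⟨hx.1, hx.2.trans hle⟩)
      fun i hi => hzero i (hi.trans n.lt_succ_self)) ?_
    have hstep : p + (n + 1 : ℕ) * δ - (p + n * δ) = δ := by push_cast; ring
    exact hU.integral_coercivityDefect_nonpos_of_short hm hM
      (fun x hx => hmM x ⟨hp.trans hx.1, hx.2⟩) (by linarith) hh (by rwa [hstep])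
      (hzero n n.lt_succ_self)

theorem exists_integral_coercivityDefect_nonpos (hm : Continuous m) (hh : 0 < h) (κ : ℝ)
    (hpq : p < q) :
    ∃ (n : ℕ) (a : Fin n → ℝ), ∀ U G : ℝ → ℂ, IsPrimitive U G → (∀ i, U (a i) = 0) →
      ∫ x in p..q, coercivityDefect h m κ 3 U G x ≤ 0 := by
  obtain ⟨M, hM⟩ := (isCompact_Icc (a := p) (b := q)).exists_bound_of_continuousOn hm.continuousOn
  have hM0 : 0 ≤ M := (norm_nonneg _).trans (hM p ⟨le_rfl, hpq.le⟩)
  have : 0 < q - p := sub_pos.2 hpq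
  obtain ⟨n, hn⟩ := exists_nat_gt ((q - p) * (|κ| + 3 * M) / h)
  have hn0 : 0 < (n : ℝ) := lt_of_le_of_lt (by positivity) hn
  have hlen : (q - p) / n * (κ + 3 * M) ≤ h := by
    rw [div_lt_iff₀ hh] at hn
    rw [div_mul_eq_mul_div, div_le_iff₀ hn0]
    nlinarith [le_abs_self κ]
  have hend : p + n * ((q - p) / n) = q := by field_simp; ring
  refine ⟨n, fun i => p + (i : ℕ) * ((q - p) / n), fun U G hU hzero => ?_⟩
  have := hU.integral_coercivityDefect_nonpos_of_subdivision hm (p := p) hM0 (by positivity) n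
    (fun x hx => (abs_le.1 (hM x (by rwa [hend] at hx))).1) hh.le hlen
    fun i hi => hzero ⟨i, hi⟩
  rwa [hend] at this

/-! ### Intervals between two zeros of `m` -/

/-- The multiplier for an interval `[p, q]` on which `m ≥ 0` may vanish at the end points:
it decreases from about `5` to about `1`, at rate about `2 c` near both end points. -/
def wellWeight (c p q x : ℝ) : ℝ :=
  3 + 2 * Real.exp (-(c * (x - p))) - 2 * Real.exp (-(c * (q - x)))

theorem hasDerivAt_wellWeight (c p q x : ℝ) :
    HasDerivAt (wellWeight c p q)
      (-(2 * c * (Real.exp (-(c * (x - p))) + Real.exp (-(c * (q - x)))))) x := by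
  have hleft := ((((hasDerivAt_id x).sub_const p).const_mul c).fun_neg.exp).const_mul 2
  have hright := ((((hasDerivAt_id x).const_sub q).const_mul c).fun_neg.exp).const_mul 2
  refine ((hleft.const_add 3).fun_sub hright).congr_deriv ?_
  simp only [id]
  ring

theorem wellWeight_mem_Icc {c x : ℝ} (hc : 0 ≤ c) (hx : x ∈ Icc p q) :
    wellWeight c p q x ∈ Icc 1 5 := by
  have hleft : Real.exp (-(c * (x - p))) ≤ 1 :=
    Real.exp_le_one_iff.2 (neg_nonpos.2 (mul_nonneg hc (sub_nonneg.2 hx.1)))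
  have hright : Real.exp (-(c * (q - x))) ≤ 1 :=
    Real.exp_le_one_iff.2 (neg_nonpos.2 (mul_nonneg hc (sub_nonneg.2 hx.2)))
  have := Real.exp_pos (-(c * (x - p)))
  have := Real.exp_pos (-(c * (q - x)))
  unfold wellWeight
  constructor <;> linarith

theorem one_le_mul_min_add_exp {c : ℝ} (y z : ℝ) :
    1 ≤ c * min y z + (Real.exp (-(c * y)) + Real.exp (-(c * z))) := by
  have hy := Real.add_one_le_exp (-(c * y))
  have hz := Real.add_one_le_exp (-(c * z))
  have := Real.exp_pos (-(c * y))
  have := Real.exp_pos (-(c * z))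
  rcases min_choice y z with hmin | hmin <;> rw [hmin] <;> linarith

/-- The exponential scale `c = s / √(h s)` of the weight balances the gain `h c` from its slope
near the end points with the gain `s / c` from the size of `m` at distance `1 / c` from them. -/
theorem sqrt_le_mul_wellWeight_sub (hh : 0 < h) (hs : 0 < s) {x y : ℝ} (hx : x ∈ Icc p q)
    (hy : s * min (x - p) (q - x) ≤ y) :
    √(h * s) ≤ y * wellWeight (s / √(h * s)) p q x -
      h / 2 * -(2 * (s / √(h * s)) * (Real.exp (-(s / √(h * s) * (x - p))) +
        Real.exp (-(s / √(h * s) * (q - x))))) := by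
  set κ := √(h * s)
  have hκ : 0 < κ := Real.sqrt_pos.2 (by positivity)
  have hκ2 : κ * κ = h * s := Real.mul_self_sqrt (by positivity)
  have hslope : h * (s / κ) = κ := by field_simp; linarith
  have hsize : κ * (s / κ) = s := by field_simp
  have hc : 0 ≤ s / κ := by positivity
  set c := s / κ
  set E := Real.exp (-(c * (x - p))) + Real.exp (-(c * (q - x)))
  have hy0 : 0 ≤ y :=
    (mul_nonneg hs.le (le_min (sub_nonneg.2 hx.1) (sub_nonneg.2 hx.2))).trans hy
  calc κ ≤ κ * (c * min (x - p) (q - x) + E) := le_mul_of_one_le_right hκ.le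
          (one_le_mul_min_add_exp _ _)
    _ = s * min (x - p) (q - x) + h * c * E := by rw [mul_add, ← mul_assoc, hsize, hslope]
    _ ≤ y * wellWeight c p q x + h * c * E := by
        gcongr ?_ + _
        exact hy.trans (le_mul_of_one_le_right hy0 (wellWeight_mem_Icc hc hx).1)
    _ = _ := by ring

theorem IsPrimitive.integral_coercivityDefect_le_of_min_le (hU : IsPrimitive U G)
    (hm : Continuous m) (hh : 0 < h) (hs : 0 < s) (hpq : p ≤ q)
    (hms : ∀ x ∈ Icc p q, s * min (x - p) (q - x) ≤ m x) :
    ∫ x in p..q, coercivityDefect h m (√(h * s)) 5 U G x ≤ h / 2 * (5 * ‖U p‖ ^ 2) := by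
  have hc : 0 ≤ s / √(h * s) := by positivity
  have hweight (x : ℝ) (hx : x ∈ Icc p q) := wellWeight_mem_Icc hc hx
  refine (hU.integral_coercivityDefect_le hm hpq (hasDerivAt_wellWeight (s / √(h * s)) p q)
    (by fun_prop)
    (fun x hx => by rw [abs_of_nonneg] <;> linarith [(hweight x hx).1, (hweight x hx).2])
    (fun x hx => sqrt_le_mul_wellWeight_sub hh hs hx (hms x hx))).trans ?_
  have hq : 0 ≤ wellWeight (s / √(h * s)) p q q * ‖U q‖ ^ 2 :=
    mul_nonneg (by linarith [(hweight q ⟨hpq, le_rfl⟩).1]) (sq_nonneg _)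
  have hp := mul_le_mul_of_nonneg_right (hweight p ⟨le_rfl, hpq⟩).2 (sq_nonneg ‖U p‖)
  gcongr
  linarith

theorem coercivityDefect_reflect (c x : ℝ) :
    coercivityDefect h (fun x => -m (c - x)) κ N (fun x => U (c - x)) (fun x => -G (c - x)) x =
      coercivityDefect h m κ N U G (c - x) := by
  simp only [coercivityDefect, firstOrderFun]
  rw [← norm_neg (_ + _)]
  congr 5
  push_cast
  ring

theorem IsPrimitive.integral_coercivityDefect_le_of_le_neg_min (hU : IsPrimitive U G)
    (hm : Continuous m) (hh : 0 < h) (hs : 0 < s) (hpq : p ≤ q)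
    (hms : ∀ x ∈ Icc p q, m x ≤ -(s * min (x - p) (q - x))) :
    ∫ x in p..q, coercivityDefect h m (√(h * s)) 5 U G x ≤ h / 2 * (5 * ‖U q‖ ^ 2) := by
  have hrefl := (hU.reflect (p + q)).integral_coercivityDefect_le_of_min_le
    (m := fun x => -m (p + q - x)) (by fun_prop) hh hs hpq fun x hx => by
      have := hms (p + q - x) ⟨by linarith [hx.2], by linarith [hx.1]⟩
      rw [show p + q - x - p = q - x by ring, show q - (p + q - x) = x - p by ring,
        min_comm] at this
      linarith
  simp only [coercivityDefect_reflect] at hrefl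
  rwa [intervalIntegral.integral_comp_sub_left, add_sub_cancel_left, add_sub_cancel_right] at hrefl

end Energy

/-! ### Weak derivatives on the line -/

theorem exists_tsupport_subset_Ioo {E : Type*} [Zero E] {f : ℝ → E} (hf : HasCompactSupport f) :
    ∃ R : ℝ, tsupport f ⊆ Ioo (-R) R := by
  obtain ⟨R, hR⟩ := hf.isCompact.isBounded.subset_ball 0
  exact ⟨R, by simpa [Real.ball_eq_Ioo] using hR⟩

theorem isPrimitive_of_mem_lineTests {p : (ℝ → ℂ) × (ℝ → ℂ)} (hp : p ∈ lineTests.pairs) :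
    IsPrimitive p.1 p.2 := by
  obtain ⟨hsmooth, -, hderiv⟩ := hp
  rw [hderiv]
  exact .of_hasDerivAt (fun x => (hsmooth.differentiable (by simp) x).hasDerivAt)
    (hsmooth.continuous_deriv (by simp))

theorem integrable_mul_of_mem_lineTests {f : ℝ → ℂ} (hf : LocallyIntegrable f volume)
    {p : (ℝ → ℂ) × (ℝ → ℂ)} (hp : p ∈ lineTests.pairs) :
    Integrable (fun x => f x * p.1 x) ∧ Integrable (fun x => f x * p.2 x) := by
  obtain ⟨hsmooth, hcomp, hderiv⟩ := hp
  rw [hderiv]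
  constructor
  · simpa [mul_comm] using hf.integrable_smul_left_of_hasCompactSupport hsmooth.continuous hcomp
  · simpa [mul_comm] using hf.integrable_smul_left_of_hasCompactSupport
      (hsmooth.continuous_deriv (by simp)) hcomp.deriv

theorem IsPrimitive.integral_mul_of_mem_lineTests {V v : ℝ → ℂ} (hV : IsPrimitive V v)
    {p : (ℝ → ℂ) × (ℝ → ℂ)} (hp : p ∈ lineTests.pairs) :
    ∫ x, V x * p.2 x = -∫ x, v x * p.1 x := by
  obtain ⟨R, hR⟩ := exists_tsupport_subset_Ioo hp.2.1
  have hfst (x : ℝ) (hx : x ∉ Ioo (-R) R) : p.1 x = 0 :=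
    image_eq_zero_of_notMem_tsupport fun h => hx (hR h)
  have hsnd (x : ℝ) (hx : x ∉ Ioo (-R) R) : p.2 x = 0 := by
    rw [hp.2.2]
    exact image_eq_zero_of_notMem_tsupport fun h => hx (hR (tsupport_deriv_subset h))
  have hsupp : Function.support (fun x => v x * p.1 x + V x * p.2 x) ⊆ Ioc (-R) R := by
    refine Function.support_subset_iff'.2 fun x hx => ?_
    have hx' : x ∉ Ioo (-R) R := fun h => hx (Ioo_subset_Ioc_self h)
    rw [hfst x hx', hsnd x hx', mul_zero, mul_zero, add_zero]
  have hzero : ∫ x, (v x * p.1 x + V x * p.2 x) = 0 := by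
    rw [← intervalIntegral.integral_eq_integral_of_support_subset hsupp,
      ← (hV.mul (isPrimitive_of_mem_lineTests hp)).sub_eq, hfst R (by simp), hfst (-R) (by simp),
      mul_zero, mul_zero, sub_zero]
  rw [integral_add (integrable_mul_of_mem_lineTests hV.locallyIntegrable hp).1
    (integrable_mul_of_mem_lineTests hV.continuous.locallyIntegrable hp).2] at hzero
  exact eq_neg_of_add_eq_zero_right hzero

theorem hasDerivAt_integral_of_contDiff {ψ : ℝ → ℂ} (hψ : ContDiff ℝ ∞ ψ) (a x : ℝ) :
    HasDerivAt (fun y => ∫ z in a..y, ψ z) (ψ x) x :=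
  (hψ.continuous.integral_hasStrictDerivAt a x).hasDerivAt

theorem contDiff_integral_of_contDiff {ψ : ℝ → ℂ} (hψ : ContDiff ℝ ∞ ψ) (a : ℝ) :
    ContDiff ℝ ∞ fun y => ∫ z in a..y, ψ z := by
  rw [contDiff_infty_iff_deriv, funext fun y => (hasDerivAt_integral_of_contDiff hψ a y).deriv]
  exact ⟨fun y => (hasDerivAt_integral_of_contDiff hψ a y).differentiableAt, hψ⟩

theorem exists_mem_lineTests_of_integral_eq_zero {ψ : ℝ → ℂ} (hψ : ContDiff ℝ ∞ ψ)
    (hc : HasCompactSupport ψ) (hint : ∫ x, ψ x = 0) : ∃ φ, (φ, ψ) ∈ lineTests.pairs := by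
  obtain ⟨R, hR⟩ := exists_tsupport_subset_Ioo hc
  have hzero (x : ℝ) (hx : x ∉ Ioo (-R) R) : ψ x = 0 :=
    image_eq_zero_of_notMem_tsupport fun h => hx (hR h)
  refine ⟨fun y => ∫ x in (-R)..y, ψ x, contDiff_integral_of_contDiff hψ _, ?_,
    funext fun y => (hasDerivAt_integral_of_contDiff hψ _ y).deriv.symm⟩
  refine HasCompactSupport.intro (isCompact_Icc (a := -R) (b := R)) fun y hy => ?_
  rcases lt_or_ge y (-R) with hlt | hge
  · refine intervalIntegral.integral_zero_ae (ae_of_all _ fun x hx => hzero x fun hx' => ?_)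
    rw [uIoc_of_ge hlt.le] at hx
    linarith [hx.2, hx'.1]
  · have hRy : R < y := not_le.1 fun h => hy ⟨hge, h⟩
    rw [← hint]
    refine intervalIntegral.integral_eq_integral_of_support_subset fun x hx => ?_
    have hxR := hR (subset_tsupport ψ hx)
    exact ⟨hxR.1, (hxR.2.trans hRy).le⟩

/-- The lemma of du Bois-Reymond. -/
theorem ae_eq_const_of_lineTests {f : ℝ → ℂ} (hf : LocallyIntegrable f volume)
    (hweak : ∀ p ∈ lineTests.pairs, ∫ x, f x * p.2 x = 0) : ∃ c : ℂ, ∀ᵐ x, f x = c := by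
  let b : ContDiffBump (0 : ℝ) := ⟨1, 2, one_pos, one_lt_two⟩
  let η : ℝ → ℝ := b.normed volume
  have hη : ContDiff ℝ ∞ η := b.contDiff_normed
  have hηc : HasCompactSupport η := b.hasCompactSupport_normed
  have hint (g : ℝ → ℝ) (hg : ContDiff ℝ ∞ g) (hgc : HasCompactSupport g) :
      Integrable fun x => (g x : ℂ) * f x := by
    simpa using hf.integrable_smul_left_of_hasCompactSupport hg.continuous hgc
  let c : ℂ := ∫ x, (η x : ℂ) * f x
  suffices hsub : ∀ᵐ x, f x - c = 0 from ⟨c, hsub.mono fun x hx => sub_eq_zero.1 hx⟩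
  refine ae_eq_zero_of_integral_contDiff_smul_eq_zero
    (hf.sub (locallyIntegrable_const c)) fun g hg hgc => ?_
  set I := ∫ x, g x
  have hgi : Integrable g := hg.continuous.integrable_of_hasCompactSupport hgc
  have hηi : Integrable η := hη.continuous.integrable_of_hasCompactSupport hηc
  obtain ⟨φ, hφ⟩ := exists_mem_lineTests_of_integral_eq_zero
    (ψ := fun x => ((g x - I * η x : ℝ) : ℂ))
    (Complex.ofRealCLM.contDiff.comp (hg.sub (contDiff_const.mul hη)))
    ((hgc.sub hηc.mul_left).comp_left Complex.ofReal_zero) (by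
      rw [integral_complex_ofReal, integral_sub hgi (hηi.const_mul I), integral_const_mul,
        b.integral_normed, mul_one, sub_self, Complex.ofReal_zero])
  calc ∫ x, g x • (f x - c) = (∫ x, (g x : ℂ) * f x) - (∫ x, (g x : ℂ)) * c := by
        have hgc' : Integrable fun x => (g x : ℂ) * c := hgi.ofReal.mul_const c
        rw [← integral_mul_const, ← integral_sub (hint g hg hgc) hgc']
        simp only [Complex.real_smul, mul_sub]
    _ = (∫ x, (g x : ℂ) * f x) - I * c := by rw [integral_complex_ofReal]
    _ = ∫ x, f x * ((g x - I * η x : ℝ) : ℂ) := by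
        rw [← integral_const_mul, ← integral_sub (hint g hg hgc) ((hint η hη hηc).const_mul _)]
        refine integral_congr_ae (ae_of_all _ fun x => ?_)
        push_cast
        ring
    _ = 0 := hweak _ hφ

theorem IsPrimitive.add_const {U G : ℝ → ℂ} (hU : IsPrimitive U G) (c : ℂ) :
    IsPrimitive (fun x => U x + c) G :=
  ⟨hU.intervalIntegrable, fun a b => by rw [← hU.sub_eq, add_sub_add_right_eq_sub]⟩

theorem IsWeakDeriv.exists_isPrimitive_line {u v : Lp ℂ 2 (volume : Measure ℝ)}
    (h : IsWeakDeriv lineTests u v) : ∃ U : ℝ → ℂ, IsPrimitive U v ∧ ∀ᵐ x, u x = U x := by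
  have hloc (w : Lp ℂ 2 (volume : Measure ℝ)) : LocallyIntegrable w volume :=
    (Lp.memLp w).locallyIntegrable (by norm_num)
  have hV := IsPrimitive.integral (G := v) fun a b =>
    ((hloc v).integrableOn_isCompact isCompact_uIcc).intervalIntegrable
  set V : ℝ → ℂ := fun x => ∫ y in (0 : ℝ)..x, v y
  have hVloc := hV.continuous.locallyIntegrable (μ := volume)
  obtain ⟨c, hc⟩ := ae_eq_const_of_lineTests (f := fun x => u x - V x) ((hloc u).sub hVloc)
    fun p hp => by
      simp only [sub_mul]
      rw [integral_sub (integrable_mul_of_mem_lineTests (hloc u) hp).2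
        (integrable_mul_of_mem_lineTests hVloc hp).2, h p hp,
        hV.integral_mul_of_mem_lineTests hp, sub_self]
  exact ⟨fun x => V x + c, hV.add_const c, hc.mono fun x hx => by simp [← hx]⟩

/-! ### Weak derivatives on the circle -/

theorem quasiMeasurePreserving_circ :
    Measure.QuasiMeasurePreserving (fun x : ℝ => (x : Circ)) volume volume := by
  refine ⟨AddCircle.measurable_mk', ?_⟩
  rw [← (AddCircle.measurePreserving_mk (2 * Real.pi) 0).map_eq]
  exact (isAddFundamentalDomain_Ioc' Real.two_pi_pos 0).absolutelyContinuous_map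

theorem continuous_circ_iff {f : Circ → ℂ} :
    Continuous f ↔ Continuous fun x : ℝ => f (x : Circ) :=
  isQuotientMap_quotient_mk'.continuous_iff

theorem memLp_circ_of_continuous {f : Circ → ℂ} (hf : Continuous f) :
    MemLp f 2 (volume : Measure Circ) :=
  hf.memLp_of_hasCompactSupport (HasCompactSupport.of_compactSpace f)

theorem integrable_mul_of_memLp_two {f g : Circ → ℂ} (hf : MemLp f 2 (volume : Measure Circ))
    (hg : MemLp g 2 (volume : Measure Circ)) :
    Integrable (fun y => f y * g y) (volume : Measure Circ) :=
  hf.integrable_mul hg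

theorem intervalIntegrable_circ {f : Circ → ℂ} (hf : Integrable f volume) (a b : ℝ) :
    IntervalIntegrable (fun x : ℝ => f (x : Circ)) volume a b := by
  have hper : Function.Periodic (fun x : ℝ => f (x : Circ)) (2 * Real.pi) := fun x => by
    simp only [AddCircle.coe_add_period]
  refine hper.intervalIntegrable₀ Real.two_pi_pos.ne' ?_ a b
  rw [intervalIntegrable_iff_integrableOn_Ioc_of_le Real.two_pi_pos.le]
  have := (AddCircle.measurePreserving_mk (2 * Real.pi) 0).integrable_comp_of_integrable hf
  rwa [zero_add] at this

theorem IsPrimitive.add_two_pi_sub {U : ℝ → ℂ} {g : Circ → ℂ}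
    (hU : IsPrimitive U fun x => g (x : Circ)) (x : ℝ) :
    U (x + 2 * Real.pi) - U x = ∫ y, g y := by
  rw [hU.sub_eq, AddCircle.intervalIntegral_preimage]

theorem IsPrimitive.integral_circ_eq_zero {f g : Circ → ℂ}
    (hf : IsPrimitive (fun x => f (x : Circ)) fun x => g (x : Circ)) : ∫ y, g y = 0 := by
  rw [← hf.add_two_pi_sub 0, AddCircle.coe_add_period, sub_self]

theorem isPrimitive_of_mem_circTests {p : (Circ → ℂ) × (Circ → ℂ)}
    (hp : p ∈ circTests.pairs) :
    IsPrimitive (fun x => p.1 (x : Circ)) fun x => p.2 (x : Circ) := by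
  obtain ⟨hsmooth, hderiv⟩ := hp
  simp only [hderiv]
  exact .of_hasDerivAt (fun x => (hsmooth.differentiable (by simp) x).hasDerivAt)
    (hsmooth.continuous_deriv (by simp))

theorem IsPrimitive.integral_mul_of_mem_circTests {V v : Circ → ℂ}
    (hV : IsPrimitive (fun x => V (x : Circ)) fun x => v (x : Circ)) (hv : MemLp v 2 volume)
    {p : (Circ → ℂ) × (Circ → ℂ)} (hp : p ∈ circTests.pairs) :
    ∫ y, V y * p.2 y = -∫ y, v y * p.1 y := by
  have hzero := IsPrimitive.integral_circ_eq_zero (f := fun y => V y * p.1 y)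
    (g := fun y => v y * p.1 y + V y * p.2 y) (hV.mul (isPrimitive_of_mem_circTests hp))
  rw [integral_add (integrable_mul_of_memLp_two hv (circTests.memLp p hp).1)
    (integrable_mul_of_memLp_two (memLp_circ_of_continuous (continuous_circ_iff.2 hV.continuous))
      (circTests.memLp p hp).2)] at hzero
  exact eq_neg_of_add_eq_zero_right hzero

theorem exists_mem_circTests_of_integral_eq_zero {ψ : Circ → ℂ}
    (hψ : ContDiff ℝ ∞ fun x : ℝ => ψ (x : Circ)) (hint : ∫ y, ψ y = 0) :
    ∃ φ, (φ, ψ) ∈ circTests.pairs := by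
  have hderiv := hasDerivAt_integral_of_contDiff hψ 0
  have hper : Function.Periodic (fun x : ℝ => ∫ y in (0 : ℝ)..x, ψ (y : Circ)) (2 * Real.pi) :=
    fun x => sub_eq_zero.1 <|
      ((IsPrimitive.of_hasDerivAt hderiv hψ.continuous).add_two_pi_sub x).trans hint
  refine ⟨hper.lift, ?_, fun y => ?_⟩ <;> simp only [Function.Periodic.lift_coe]
  · exact contDiff_integral_of_contDiff hψ 0
  · exact (hderiv y).deriv.symm

/-- The lemma of du Bois-Reymond on the circle. -/
theorem ae_eq_const_of_circTests {f : Circ → ℂ} (hf : MemLp f 2 volume)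
    (hweak : ∀ p ∈ circTests.pairs, ∫ y, f y * p.2 y = 0) : ∃ c : ℂ, ∀ᵐ y, f y = c := by
  set c : ℂ := ⨍ y, f y
  have hfc : MemLp (fun y => f y - c) 2 (volume : Measure Circ) := hf.sub (memLp_const c)
  suffices hzero : hfc.toLp = 0 by
    refine ⟨c, ?_⟩
    filter_upwards [hfc.coeFn_toLp, Lp.eq_zero_iff_ae_eq_zero.1 hzero] with y hy hy0
    exact sub_eq_zero.1 (hy.symm.trans hy0)
  refine circTests.separating _ fun p hp => ?_
  have hp1 := (circTests.memLp p hp).1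
  set d : ℂ := ⨍ y, p.1 y
  have hmean : ∫ y, (p.1 y - d) = 0 := integral_sub_average volume p.1
  obtain ⟨φ, hφ⟩ := exists_mem_circTests_of_integral_eq_zero (ψ := fun y => p.1 y - d)
    (hp.1.sub contDiff_const) hmean
  have hpd : MemLp (fun y => p.1 y - d) 2 (volume : Measure Circ) := hp1.sub (memLp_const d)
  have hfpd := integrable_mul_of_memLp_two hf hpd
  have hcpd := (hpd.integrable (by norm_num)).const_mul c
  have hdiff : Integrable (fun y => f y * (p.1 y - d) - c * (p.1 y - d))
      (volume : Measure Circ) := hfpd.sub hcpd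
  calc ∫ y, (hfc.toLp : Lp ℂ 2 (volume : Measure Circ)) y * p.1 y
      = ∫ y, (f y - c) * p.1 y :=
        integral_congr_ae (hfc.coeFn_toLp.mono fun y hy => congrArg (· * p.1 y) hy)
    _ = ∫ y, ((f y * (p.1 y - d) - c * (p.1 y - d)) + (f y - c) * d) := by
        congr with y; ring
    _ = 0 := by
        rw [integral_add hdiff ((hfc.integrable (by norm_num)).mul_const d),
          integral_sub hfpd hcpd, hweak _ hφ, integral_const_mul, hmean, integral_mul_const,
          integral_sub_average]
        ring

theorem IsWeakDeriv.integral_circ_eq_zero {u v : Lp ℂ 2 (volume : Measure Circ)}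
    (h : IsWeakDeriv circTests u v) : ∫ y, v y = 0 := by
  simpa using h (fun _ => 1, fun _ => 0) ⟨contDiff_const, fun y => by simp⟩

theorem IsWeakDeriv.exists_isPrimitive_circ {u v : Lp ℂ 2 (volume : Measure Circ)}
    (h : IsWeakDeriv circTests u v) :
    ∃ U : ℝ → ℂ, IsPrimitive U (fun x => v (x : Circ)) ∧ ∀ᵐ x : ℝ, u (x : Circ) = U x := by
  have hV := IsPrimitive.integral
    (intervalIntegrable_circ ((Lp.memLp v).integrable (by norm_num)))
  set V : ℝ → ℂ := fun x => ∫ y in (0 : ℝ)..x, v (y : Circ)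
  have hper : Function.Periodic V (2 * Real.pi) := fun x =>
    sub_eq_zero.1 ((hV.add_two_pi_sub x).trans h.integral_circ_eq_zero)
  have hW : IsPrimitive (fun x => hper.lift (x : Circ)) fun x => v (x : Circ) := by
    simpa only [Function.Periodic.lift_coe] using hV
  have hWmem := memLp_circ_of_continuous (continuous_circ_iff.2 hW.continuous)
  obtain ⟨c, hc⟩ := ae_eq_const_of_circTests ((Lp.memLp u).sub hWmem) fun p hp => by
    simp only [Pi.sub_apply, sub_mul]
    rw [integral_sub (integrable_mul_test u (circTests.memLp p hp).2)
      (integrable_mul_of_memLp_two hWmem (circTests.memLp p hp).2), h p hp,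
      hW.integral_mul_of_mem_circTests (Lp.memLp v) hp, sub_self]
  refine ⟨fun x => V x + c, hV.add_const c, ?_⟩
  filter_upwards [quasiMeasurePreserving_circ.ae hc] with x hx
  rw [← hx, Pi.sub_apply, Function.Periodic.lift_coe, add_sub_cancel]

/-! ### First order operators -/

section FirstOrder

variable {Y : Type*} [MeasurableSpace Y] {μ : Measure Y}

theorem norm_sq_eq_integral (f : Lp ℂ 2 μ) : ‖f‖ ^ 2 = ∫ y, ‖f y‖ ^ 2 ∂μ := by
  rw [← inner_self_eq_norm_sq (𝕜 := ℂ), L2.inner_def]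
  simp only [inner_self_eq_norm_sq_to_K]
  norm_cast

theorem integrable_norm_sq (f : Lp ℂ 2 μ) : Integrable (fun y => ‖f y‖ ^ 2) μ :=
  (memLp_two_iff_integrable_sq_norm (Lp.memLp f).1).1 (Lp.memLp f)

theorem integrable_norm_mul_norm (f g : Lp ℂ 2 μ) : Integrable (fun y => ‖f y‖ * ‖g y‖) μ :=
  MemLp.integrable_mul (Lp.memLp f).norm (Lp.memLp g).norm

theorem integral_norm_mul_norm_le (f g : Lp ℂ 2 μ) : ∫ y, ‖f y‖ * ‖g y‖ ∂μ ≤ ‖f‖ * ‖g‖ := by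
  have hnorm (f : Lp ℂ 2 μ) : ‖(Lp.memLp f).norm.toLp‖ = ‖f‖ := by
    rw [Lp.norm_toLp, eLpNorm_norm, Lp.norm_def]
  have hinner := real_inner_le_norm (Lp.memLp g).norm.toLp (Lp.memLp f).norm.toLp
  rw [hnorm, hnorm, L2.inner_def, mul_comm] at hinner
  refine (integral_congr_ae ?_).trans_le hinner
  filter_upwards [(Lp.memLp f).norm.coeFn_toLp, (Lp.memLp g).norm.coeFn_toLp] with y hf hg
  simp [hf, hg]

theorem mul_norm_le_of_integral_nonpos {u f : Lp ℂ 2 μ} {κ N : ℝ} (hN : 0 ≤ N)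
    (hle : ∫ y, (κ * ‖u y‖ ^ 2 - N * (‖f y‖ * ‖u y‖)) ∂μ ≤ 0) : κ * ‖u‖ ≤ N * ‖f‖ := by
  rw [integral_sub ((integrable_norm_sq u).const_mul κ)
    ((integrable_norm_mul_norm f u).const_mul N), integral_const_mul, integral_const_mul,
    ← norm_sq_eq_integral] at hle
  have hholder := mul_le_mul_of_nonneg_left (integral_norm_mul_norm_le f u) hN
  rcases (norm_nonneg u).eq_or_lt with hzero | hpos
  · rw [← hzero, mul_zero]
    positivity
  · refine le_of_mul_le_mul_right ?_ hpos
    linarith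

theorem integral_toLp_mul {f : Y → ℂ} (hf : MemLp f 2 μ) (φ : Y → ℂ) :
    ∫ y, (hf.toLp : Lp ℂ 2 μ) y * φ y ∂μ = ∫ y, f y * φ y ∂μ :=
  integral_congr_ae (hf.coeFn_toLp.mono fun y hy => congrArg (· * φ y) hy)

theorem continuous_integral_mul {φ : Y → ℂ} (hφ : MemLp φ 2 μ) :
    Continuous fun u : Lp ℂ 2 μ => ∫ y, u y * φ y ∂μ := by
  have hinner : (fun u : Lp ℂ 2 μ => ∫ y, u y * φ y ∂μ) = fun u => inner ℂ hφ.star.toLp u := by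
    funext u
    rw [L2.inner_def]
    refine integral_congr_ae (hφ.star.coeFn_toLp.mono fun y hy => ?_)
    simp [hy]
  rw [hinner]
  fun_prop

/-- Along `π : ℝ → Y`, a function with a weak derivative is a primitive of that derivative.
For the line `π` is the identity, for the circle the quotient map. -/
structure HasPrimitives (T : TestClass μ) (π : ℝ → Y) : Prop where
  quasi : Measure.QuasiMeasurePreserving π volume μ
  exists_isPrimitive : ∀ u v : Lp ℂ 2 μ, IsWeakDeriv T u v →
    ∃ U : ℝ → ℂ, IsPrimitive U (fun x => v (π x)) ∧ ∀ᵐ x, u (π x) = U x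

variable {T : TestClass μ} {π : ℝ → Y} {w : Y → ℝ}

/-- The continuous representative of an element of `weightedH1`, lifted to `ℝ`. -/
def continuousRep (hT : HasPrimitives T π) (w : Y → ℝ) : weightedH1 T w →ₗ[ℂ] (ℝ → ℂ) where
  toFun u := (hT.exists_isPrimitive _ _ (weakDeriv_spec u)).choose
  map_add' u v := by
    have hu := (hT.exists_isPrimitive _ _ (weakDeriv_spec u)).choose_spec
    have hv := (hT.exists_isPrimitive _ _ (weakDeriv_spec v)).choose_spec
    have huv := (hT.exists_isPrimitive _ _ (weakDeriv_spec (u + v))).choose_spec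
    refine (Continuous.ae_eq_iff_eq volume huv.1.continuous
      (hu.1.continuous.add hv.1.continuous)).1 ?_
    filter_upwards [hu.2, hv.2, huv.2,
      hT.quasi.ae (Lp.coeFn_add (u : Lp ℂ 2 μ) v)] with x hux hvx huvx hadd
    rw [← huvx, Submodule.coe_add, hadd, Pi.add_apply, Pi.add_apply, hux, hvx]
  map_smul' c u := by
    have hu := (hT.exists_isPrimitive _ _ (weakDeriv_spec u)).choose_spec
    have hcu := (hT.exists_isPrimitive _ _ (weakDeriv_spec (c • u))).choose_spec
    refine (Continuous.ae_eq_iff_eq volume hcu.1.continuous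
      (hu.1.continuous.const_smul c)).1 ?_
    filter_upwards [hu.2, hcu.2,
      hT.quasi.ae (Lp.coeFn_smul c (u : Lp ℂ 2 μ))] with x hux hcux hsmul
    rw [← hcux, Submodule.coe_smul, hsmul, Pi.smul_apply, Pi.smul_apply, hux]

theorem isPrimitive_continuousRep (hT : HasPrimitives T π) (u : weightedH1 T w) :
    IsPrimitive (continuousRep hT w u) fun x => weakDeriv u (π x) :=
  (hT.exists_isPrimitive _ _ (weakDeriv_spec u)).choose_spec.1

theorem ae_eq_continuousRep (hT : HasPrimitives T π) (u : weightedH1 T w) :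
    ∀ᵐ x, (u : Lp ℂ 2 μ) (π x) = continuousRep hT w u x :=
  (hT.exists_isPrimitive _ _ (weakDeriv_spec u)).choose_spec.2

variable {m : Y → ℝ} {hm : AEStronglyMeasurable m μ} {hmw : ∃ c : ℝ, ∀ y, |m y| ≤ c * w y} {h : ℝ}

theorem firstOrderOp_apply (u : weightedH1 T w) : firstOrderOp T w m hm hmw h u =
    (h : ℂ) • weakDeriv u + (memLp_mul hm hmw u).toLp :=
  rfl

theorem firstOrderOp_ae_eq (hT : HasPrimitives T π) (u : weightedH1 T w) :
    ∀ᵐ x, (firstOrderOp T w m hm hmw h u : Lp ℂ 2 μ) (π x) =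
      firstOrderFun h (fun x => m (π x)) (continuousRep hT w u) (fun x => weakDeriv u (π x)) x := by
  rw [firstOrderOp_apply]
  filter_upwards [ae_eq_continuousRep hT u, hT.quasi.ae (Lp.coeFn_smul (h : ℂ) (weakDeriv u)),
    hT.quasi.ae (Lp.coeFn_add ((h : ℂ) • weakDeriv u) (memLp_mul hm hmw u).toLp),
    hT.quasi.ae (memLp_mul hm hmw u).coeFn_toLp] with x hu hsmul hadd hmul
  rw [hadd, Pi.add_apply, hsmul, hmul, Pi.smul_apply, smul_eq_mul, hu, firstOrderFun]

theorem coercivityDefect_ae_eq (hT : HasPrimitives T π) (κ N : ℝ) (u : weightedH1 T w) :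
    ∀ᵐ x, κ * ‖(u : Lp ℂ 2 μ) (π x)‖ ^ 2 -
        N * (‖firstOrderOp T w m hm hmw h u (π x)‖ * ‖(u : Lp ℂ 2 μ) (π x)‖) =
      coercivityDefect h (fun x => m (π x)) κ N (continuousRep hT w u)
        (fun x => weakDeriv u (π x)) x := by
  filter_upwards [ae_eq_continuousRep hT u,
    firstOrderOp_ae_eq (hm := hm) (hmw := hmw) (h := h) hT u] with x hu hop
  rw [hu, hop, coercivityDefect]

theorem integral_comp_of_measurePreserving {s : Set ℝ}
    (hπ : MeasurePreserving π (volume.restrict s) μ) {F : Y → ℝ} (hF : Integrable F μ) :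
    ∫ x in s, F (π x) = ∫ y, F y ∂μ := by
  rw [← hπ.map_eq] at hF ⊢
  exact (integral_map hπ.aemeasurable hF.1).symm

theorem integrable_norm_sq_sub (κ N : ℝ) (u f : Lp ℂ 2 μ) :
    Integrable (fun y => κ * ‖u y‖ ^ 2 - N * (‖f y‖ * ‖u y‖)) μ :=
  ((integrable_norm_sq u).const_mul κ).sub ((integrable_norm_mul_norm f u).const_mul N)

variable {s : Set ℝ}

theorem integrableOn_coercivityDefect (hT : HasPrimitives T π)
    (hπ : MeasurePreserving π (volume.restrict s) μ) (hm : AEStronglyMeasurable m μ)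
    (hmw : ∃ c : ℝ, ∀ y, |m y| ≤ c * w y) (h κ N : ℝ) (u : weightedH1 T w) :
    IntegrableOn (coercivityDefect h (fun x => m (π x)) κ N (continuousRep hT w u)
      fun x => weakDeriv u (π x)) s :=
  (hπ.integrable_comp_of_integrable (integrable_norm_sq_sub κ N _ _)).congr
    (ae_restrict_of_ae (coercivityDefect_ae_eq (hm := hm) (hmw := hmw) hT κ N u))

theorem coerciveInCodim_firstOrderOp (hT : HasPrimitives T π)
    (hπ : MeasurePreserving π (volume.restrict s) μ) {κ N : ℝ} (hN : 0 < N) {n : ℕ}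
    (a : Fin n → ℝ) (hle : ∀ u : weightedH1 T w, (∀ i, continuousRep hT w u (a i) = 0) →
      ∫ x in s, coercivityDefect h (fun x => m (π x)) κ N (continuousRep hT w u)
        (fun x => weakDeriv u (π x)) x ≤ 0) :
    CoerciveInCodim (firstOrderOp T w m hm hmw h) (κ / N) n := by
  refine ⟨LinearMap.funLeft ℂ ℂ a ∘ₗ continuousRep hT w, fun u hu => ?_⟩
  rw [div_mul_eq_mul_div, div_le_iff₀' hN]
  refine mul_norm_le_of_integral_nonpos hN.le ?_
  rw [← integral_comp_of_measurePreserving hπ (integrable_norm_sq_sub κ N _ _)]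
  refine (integral_congr_ae (ae_restrict_of_ae ?_)).trans_le (hle u (congrFun hu))
  exact coercivityDefect_ae_eq hT κ N u

theorem dense_weightedH1 (hw : ∀ p ∈ T.pairs, MemLp (fun y => (w y : ℂ) * p.1 y) 2 μ)
    (hparts : ∀ p ∈ T.pairs, ∀ q ∈ T.pairs, ∫ y, p.1 y * q.2 y ∂μ = -∫ y, p.2 y * q.1 y ∂μ) :
    Dense (weightedH1 T w : Set (Lp ℂ 2 μ)) := by
  rw [Submodule.dense_iff_topologicalClosure_eq_top, Submodule.topologicalClosure_eq_top_iff,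
    Submodule.eq_bot_iff]
  intro u hu
  suffices hstar : star u = 0 by
    refine Lp.eq_zero_iff_ae_eq_zero.2 ?_
    filter_upwards [Lp.coeFn_star u, Lp.eq_zero_iff_ae_eq_zero.1 hstar] with y hy hy0
    exact star_eq_zero.1 (hy.symm.trans hy0)
  refine T.separating _ fun p hp => ?_
  obtain ⟨hp1, hp2⟩ := T.memLp p hp
  have hmem : hp1.toLp ∈ weightedH1 T w := by
    refine ⟨(memLp_congr_ae ?_).2 (hw p hp), hp2.toLp, fun q hq => ?_⟩
    · exact hp1.coeFn_toLp.mono fun y hy => congrArg ((w y : ℂ) * ·) hy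
    · rw [integral_toLp_mul, integral_toLp_mul, hparts p hp q hq]
  rw [← (Submodule.mem_orthogonal' _ _).1 hu _ hmem, L2.inner_def]
  refine integral_congr_ae ?_
  filter_upwards [hp1.coeFn_toLp, Lp.coeFn_star u] with y hpy huy
  simp [hpy, huy, mul_comm]

theorem memLp_ofReal_mul_of_abs_le (hm : AEStronglyMeasurable m μ)
    (hmw : ∃ c : ℝ, ∀ y, |m y| ≤ c * w y) {u : Y → ℂ} (hu : AEStronglyMeasurable u μ)
    (hwu : MemLp (fun y => (w y : ℂ) * u y) 2 μ) : MemLp (fun y => (m y : ℂ) * u y) 2 μ := by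
  obtain ⟨c, hc⟩ := hmw
  refine hwu.of_le_mul (c := |c|)
    ((Complex.continuous_ofReal.comp_aestronglyMeasurable hm).mul hu) (ae_of_all _ fun y => ?_)
  rw [norm_mul, norm_mul, ← mul_assoc, Complex.norm_real, Complex.norm_real,
    Real.norm_eq_abs, Real.norm_eq_abs, ← abs_mul]
  exact mul_le_mul_of_nonneg_right ((hc y).trans (le_abs_self _)) (norm_nonneg _)

theorem memLp_ofReal_mul_of_tendsto (hw : AEStronglyMeasurable w μ) {u : ℕ → Lp ℂ 2 μ}
    {v : Lp ℂ 2 μ} (hu : Tendsto u atTop (nhds v))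
    (hmem : ∀ n, AEStronglyMeasurable (fun y => (w y : ℂ) * u n y) μ) {B : ℝ≥0∞} (hB : B < ⊤)
    (hbound : ∀ n, eLpNorm (fun y => (w y : ℂ) * u n y) 2 μ ≤ B) :
    MemLp (fun y => (w y : ℂ) * v y) 2 μ := by
  obtain ⟨ns, -, hns⟩ := (tendstoInMeasure_of_tendsto_Lp hu).exists_seq_tendsto_ae
  refine ⟨(Complex.continuous_ofReal.comp_aestronglyMeasurable hw).mul (Lp.memLp v).1, ?_⟩
  exact (Lp.eLpNorm_le_of_ae_tendsto (u := atTop) (.of_forall fun k => hbound (ns k))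
    (fun k => hmem (ns k)) (hns.mono fun y hy => hy.const_mul _)).trans_lt hB

theorem mem_graph_firstOrderOp_iff (hh : h ≠ 0) {u f : Lp ℂ 2 μ} :
    (u, f) ∈ (firstOrderOp T w m hm hmw h).graph ↔
      MemLp (fun y => (w y : ℂ) * u y) 2 μ ∧ ∀ p ∈ T.pairs,
        ∫ y, f y * p.1 y ∂μ = ∫ y, u y * ((m y : ℂ) * p.1 y) ∂μ - h * ∫ y, u y * p.2 y ∂μ := by
  have hhC : (h : ℂ) ≠ 0 := by exact_mod_cast hh
  have hcomm (p : (Y → ℂ) × (Y → ℂ)) :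
      ∫ y, (m y : ℂ) * u y * p.1 y ∂μ = ∫ y, u y * ((m y : ℂ) * p.1 y) ∂μ :=
    integral_congr_ae (ae_of_all _ fun y => by ring)
  rw [LinearPMap.mem_graph_iff]
  constructor
  · rintro ⟨z, rfl, rfl⟩
    refine ⟨z.2.1, fun p hp => ?_⟩
    rw [show firstOrderOp T w m hm hmw h z = _ from firstOrderOp_apply z,
      integral_add_mul _ _ (T.memLp p hp).1, integral_smul_mul, integral_toLp_mul, hcomm,
      weakDeriv_spec z p hp]
    ring
  · rintro ⟨hwu, hweak⟩
    have hmu := memLp_ofReal_mul_of_abs_le hm hmw (Lp.memLp u).1 hwu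
    have hv : IsWeakDeriv T u ((h : ℂ)⁻¹ • (f + (-1 : ℂ) • hmu.toLp)) := fun p hp => by
      rw [integral_smul_mul, integral_add_mul _ _ (T.memLp p hp).1, integral_smul_mul,
        integral_toLp_mul, hcomm, hweak p hp]
      field_simp
      ring
    let z : weightedH1 T w := ⟨u, hwu, _, hv⟩
    refine ⟨z, rfl, ?_⟩
    rw [firstOrderOp_apply, (weakDeriv_spec z).unique hv, smul_inv_smul₀ hhC, neg_one_smul]
    exact neg_add_cancel_right f _

/-- The weak formulation passes to the limit by continuity, the weight by Fatou's lemma. -/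
theorem isClosed_firstOrderOp (hw : AEStronglyMeasurable w μ) (hh : h ≠ 0)
    (hmtest : ∀ p ∈ T.pairs, MemLp (fun y => (m y : ℂ) * p.1 y) 2 μ) {C : ℝ}
    (hest : ∀ u : weightedH1 T w, ‖u.2.1.toLp‖ ^ 2 ≤
      C * (‖(u : Lp ℂ 2 μ)‖ ^ 2 + ‖firstOrderOp T w m hm hmw h u‖ ^ 2)) :
    (firstOrderOp T w m hm hmw h).IsClosed := by
  refine IsSeqClosed.isClosed ?_
  rintro x ⟨u, f⟩ hx hlim
  have hu : Tendsto (fun n => (x n).1) atTop (nhds u) := (continuous_fst.tendsto _).comp hlim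
  have hf : Tendsto (fun n => (x n).2) atTop (nhds f) := (continuous_snd.tendsto _).comp hlim
  have hgraph (n : ℕ) := (mem_graph_firstOrderOp_iff hh).1 (hx n)
  refine (mem_graph_firstOrderOp_iff hh).2 ⟨?_, fun p hp => ?_⟩
  · obtain ⟨B, hB⟩ := (((hu.norm.pow 2).add (hf.norm.pow 2)).const_mul C).bddAbove_range
    refine memLp_ofReal_mul_of_tendsto hw hu (fun n => (hgraph n).1.1)
      (B := ENNReal.ofReal √B) ENNReal.ofReal_lt_top fun n => ?_
    obtain ⟨z, hz, hAz⟩ := (LinearPMap.mem_graph_iff _).1 (hx n)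
    have hbound : ‖z.2.1.toLp‖ ^ 2 ≤ B := by
      refine (hest z).trans (hB ⟨n, ?_⟩)
      rw [hz, hAz]
    rw [← hz, ← ENNReal.ofReal_toReal z.2.1.2.ne, ← Lp.norm_toLp _ z.2.1]
    exact ENNReal.ofReal_le_ofReal (Real.le_sqrt_of_sq_le hbound)
  · have hlim_test {φ : Y → ℂ} (hφ : MemLp φ 2 μ) {g : ℕ → Lp ℂ 2 μ} {g' : Lp ℂ 2 μ}
        (hg : Tendsto g atTop (nhds g')) :=
      ((continuous_integral_mul hφ).tendsto g').comp hg
    exact tendsto_nhds_unique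
      ((hlim_test (T.memLp p hp).1 hf).congr fun n => (hgraph n).2 p hp)
      ((hlim_test (hmtest p hp) hu).sub ((hlim_test (T.memLp p hp).2 hu).const_mul _))

end FirstOrder

/-! ### The operator on the circle -/

theorem hasPrimitives_circ : HasPrimitives circTests fun x : ℝ => (x : Circ) :=
  ⟨quasiMeasurePreserving_circ, fun _ _ h => h.exists_isPrimitive_circ⟩

theorem circCos_coe (x : ℝ) : circCos (x : Circ) = Real.cos x :=
  Real.cos_periodic.lift_coe x

theorem periodic_continuousRep_circ {w : Circ → ℝ} (u : weightedH1 circTests w) :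
    Function.Periodic (continuousRep hasPrimitives_circ w u) (2 * Real.pi) := fun x =>
  sub_eq_zero.1 <| ((isPrimitive_continuousRep hasPrimitives_circ u).add_two_pi_sub x).trans
    (weakDeriv_spec u).integral_circ_eq_zero

theorem coerciveInCodim_PCirc {h ξ κ N : ℝ} (hN : 0 < N) (p : ℝ) {n : ℕ} (a : Fin n → ℝ)
    (hle : ∀ U G : ℝ → ℂ, IsPrimitive U G → Function.Periodic U (2 * Real.pi) →
      (∀ i, U (a i) = 0) →
        ∫ x in p..p + 2 * Real.pi, coercivityDefect h (fun x => ξ + Real.cos x) κ N U G x ≤ 0) :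
    CoerciveInCodim (PCirc h ξ) (κ / N) n := by
  refine coerciveInCodim_firstOrderOp hasPrimitives_circ
    (AddCircle.measurePreserving_mk (2 * Real.pi) p) hN a fun u hu => ?_
  rw [← intervalIntegral.integral_of_le (le_add_of_nonneg_right Real.two_pi_pos.le)]
  simp only [circCos_coe]
  exact hle _ _ (isPrimitive_continuousRep hasPrimitives_circ u) (periodic_continuousRep_circ u) hu

theorem dense_domain_PCirc (h ξ : ℝ) :
    Dense ((PCirc h ξ).domain : Set (Lp ℂ 2 (volume : Measure Circ))) := by
  refine dense_weightedH1 (fun p hp => ?_) fun p hp q hq =>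
    (isPrimitive_of_mem_circTests hp).integral_mul_of_mem_circTests (circTests.memLp p hp).2 hq
  simpa using (circTests.memLp p hp).1

theorem isClosed_PCirc {h : ℝ} (hh : h ≠ 0) (ξ : ℝ) : (PCirc h ξ).IsClosed := by
  refine isClosed_firstOrderOp (C := 1) aestronglyMeasurable_const hh (fun p hp => ?_) fun u => ?_
  · exact memLp_circ_of_continuous ((Complex.continuous_ofReal.comp
      (continuous_const.add continuous_circCos)).mul (continuous_circ_iff.2 hp.1.continuous))
  · have hweight : (u.2.1.toLp : Lp ℂ 2 (volume : Measure Circ)) = u :=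
      Lp.ext (u.2.1.coeFn_toLp.trans (.of_eq (by simp)))
    rw [hweight, one_mul]
    exact le_add_of_nonneg_right (sq_nonneg _)

theorem not_finiteDimensional_circ : ¬ FiniteDimensional ℂ (Lp ℂ 2 (volume : Measure Circ)) := by
  intro hfin
  have hfourier : LinearIndependent ℂ fun n : ℤ => fourier (T := 2 * Real.pi) n :=
    .of_comp (ContinuousMap.toLp 2 (AddCircle.haarAddCircle (T := 2 * Real.pi)) ℂ).toLinearMap
      (orthonormal_fourier (T := 2 * Real.pi)).linearIndependent
  have hLp := hfourier.map' (ContinuousMap.toLp (E := ℂ) 2 (volume : Measure Circ) ℂ).toLinearMap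
    (LinearMap.ker_eq_bot.2 (ContinuousMap.toLp_injective (𝕜 := ℂ) (volume : Measure Circ)))
  have := hLp.finite
  exact not_finite ℤ

theorem exists_isSingularValueSeq_PCirc {h : ℝ} (hh : 0 < h) (ξ : ℝ) :
    ∃ t : ℕ → ℝ, IsSingularValueSeq (PCirc h ξ) t := by
  refine exists_isSingularValueSeq not_finiteDimensional_circ (dense_domain_PCirc h ξ)
    (isClosed_PCirc hh.ne' ξ) fun κ => ?_
  obtain ⟨n, a, ha⟩ := exists_integral_coercivityDefect_nonpos (m := fun x => ξ + Real.cos x)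
    (by fun_prop) hh (κ * 3) (lt_add_of_pos_right 0 Real.two_pi_pos)
  refine ⟨n, ?_⟩
  rw [← mul_div_cancel_right₀ κ (three_ne_zero (α := ℝ))]
  exact coerciveInCodim_PCirc three_pos 0 a fun U G hU _ => ha U G hU

theorem mul_cos_le_sin {y : ℝ} (hy : 0 ≤ y) (hyπ : y ≤ Real.pi) : y * Real.cos y ≤ Real.sin y := by
  rcases lt_or_ge y (Real.pi / 2) with hlt | hge
  · have hcos := Real.cos_pos_of_mem_Ioo ⟨by linarith [Real.pi_pos], hlt⟩
    rw [← le_div_iff₀ hcos, ← Real.tan_eq_sin_div_cos]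
    exact Real.le_tan hy hlt
  · have hcos := Real.cos_nonpos_of_pi_div_two_le_of_le hge (by linarith [Real.pi_pos])
    exact (mul_nonpos_of_nonneg_of_nonpos hy hcos).trans (Real.sin_nonneg_of_nonneg_of_le_pi hy hyπ)

theorem sin_mul_le_cos_sub_cos {x α : ℝ} (hx : 0 ≤ x) (hxα : x ≤ α) (hα : α ≤ Real.pi) :
    Real.sin α / 2 * (α - x) ≤ Real.cos x - Real.cos α := by
  obtain ⟨A, B, rfl, rfl⟩ : ∃ A B : ℝ, x = A - B ∧ α = A + B :=
    ⟨(α + x) / 2, (α - x) / 2, by ring, by ring⟩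
  have hB : 0 ≤ B := by linarith
  have hBA : B ≤ A := by linarith
  have hA : 0 ≤ A := hB.trans hBA
  have hAπ : A ≤ Real.pi := by linarith
  have hBπ : B ≤ Real.pi := hBA.trans hAπ
  have hsinA := Real.sin_nonneg_of_nonneg_of_le_pi hA hAπ
  have hsinB := Real.sin_nonneg_of_nonneg_of_le_pi hB hBπ
  have hcosA : B * Real.cos A ≤ Real.sin A := by
    rcases le_total 0 (Real.cos A) with hcos | hcos
    · exact (mul_le_mul_of_nonneg_right hBA hcos).trans (mul_cos_le_sin hA hAπ)
    · exact (mul_nonpos_of_nonneg_of_nonpos hB hcos).trans hsinA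
  calc Real.sin (A + B) / 2 * (A + B - (A - B))
      = Real.sin A * (B * Real.cos B) + B * Real.cos A * Real.sin B := by
        rw [Real.sin_add]
        ring
    _ ≤ Real.sin A * Real.sin B + Real.sin A * Real.sin B :=
        add_le_add (mul_le_mul_of_nonneg_left (mul_cos_le_sin hB hBπ) hsinA)
          (mul_le_mul_of_nonneg_right hcosA hsinB)
    _ = Real.cos (A - B) - Real.cos (A + B) := by
        rw [Real.cos_add, Real.cos_sub]
        ring

theorem sqrt_mul_le_add_one_sub_cos {δ z : ℝ} (hδ : 0 ≤ δ) (hz : |z| ≤ Real.pi) :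
    √δ / 2 * z ≤ δ + (1 - Real.cos z) := by
  have hcos := Real.cos_le_one_sub_mul_cos_sq hz
  have hπ : 1 / 8 * z ^ 2 ≤ 2 / Real.pi ^ 2 * z ^ 2 := by
    refine mul_le_mul_of_nonneg_right ?_ (sq_nonneg z)
    rw [div_le_div_iff₀ (by norm_num) (by positivity)]
    nlinarith [Real.pi_le_four, Real.pi_pos]
  nlinarith [Real.sq_sqrt hδ, sq_nonneg (√δ - z / 4), sq_nonneg z]

theorem sqrt_mul_arccos_sub_abs_le {ξ x : ℝ} (hξ : -1 ≤ ξ) (hx : |x| ≤ Real.arccos (-ξ)) :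
    √|1 - abs ξ| / 2 * (Real.arccos (-ξ) - |x|) ≤ ξ + Real.cos x := by
  have hx0 := sub_nonneg.2 hx
  rcases le_or_gt ξ 1 with hle | hlt
  · have habs : |ξ| ≤ 1 := abs_le.2 ⟨hξ, hle⟩
    have hchord := sin_mul_le_cos_sub_cos (abs_nonneg x) hx (Real.arccos_le_pi _)
    rw [Real.cos_abs, Real.cos_arccos (by linarith) (by linarith)] at hchord
    have hsin : √|1 - abs ξ| ≤ Real.sin (Real.arccos (-ξ)) := by
      rw [Real.sin_arccos, neg_sq, abs_of_nonneg (sub_nonneg.2 habs), ← sq_abs]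
      gcongr
      nlinarith [abs_nonneg ξ]
    calc _ ≤ Real.sin (Real.arccos (-ξ)) / 2 * (Real.arccos (-ξ) - |x|) := by gcongr
      _ ≤ _ := by linarith
  · rw [Real.arccos_of_le_neg_one (by linarith)] at hx0 ⊢
    have hquad := sqrt_mul_le_add_one_sub_cos (δ := ξ - 1) (by linarith)
      (abs_le.2 ⟨by linarith [Real.pi_pos], sub_le_self _ (abs_nonneg x)⟩)
    rw [Real.cos_pi_sub, Real.cos_abs] at hquad
    rw [abs_of_pos (zero_lt_one.trans hlt), abs_sub_comm, abs_of_pos (sub_pos.2 hlt)]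
    linarith

theorem min_eq_sub_abs (x c r : ℝ) : min (x - (c - r)) (c + r - x) = r - |x - c| := by
  rcases le_total c x with h | h
  · rw [abs_of_nonneg (sub_nonneg.2 h), min_eq_right (by linarith)]
    ring
  · rw [abs_of_nonpos (sub_nonpos.2 h), min_eq_left (by linarith)]
    ring

theorem IsPrimitive.integral_coercivityDefect_cos_le_left {U G : ℝ → ℂ} (hU : IsPrimitive U G)
    {h ξ : ℝ} (hh : 0 < h) (hξ : |ξ| ≠ 1) :
    ∫ x in -Real.arccos (-ξ)..Real.arccos (-ξ), coercivityDefect h (fun x => ξ + Real.cos x)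
      √(h * (√|1 - abs ξ| / 2)) 5 U G x ≤ h / 2 * (5 * ‖U (-Real.arccos (-ξ))‖ ^ 2) := by
  rcases le_or_gt (-1) ξ with hle | hlt
  · have hs : 0 < √|1 - abs ξ| / 2 :=
      half_pos (Real.sqrt_pos.2 (abs_pos.2 (sub_ne_zero.2 hξ.symm)))
    refine hU.integral_coercivityDefect_le_of_min_le (by fun_prop) hh hs
      (neg_le_self (Real.arccos_nonneg _)) fun x hx => ?_
    have hmin := min_eq_sub_abs x 0 (Real.arccos (-ξ))
    rw [zero_sub, zero_add, sub_zero] at hmin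
    rw [hmin]
    exact sqrt_mul_arccos_sub_abs_le hle (abs_le.2 hx)
  · rw [Real.arccos_of_one_le (by linarith), neg_zero, intervalIntegral.integral_same]
    positivity

theorem IsPrimitive.integral_coercivityDefect_cos_le_right {U G : ℝ → ℂ} (hU : IsPrimitive U G)
    {h ξ : ℝ} (hh : 0 < h) (hξ : |ξ| ≠ 1) :
    ∫ x in Real.arccos (-ξ)..-Real.arccos (-ξ) + 2 * Real.pi,
      coercivityDefect h (fun x => ξ + Real.cos x) √(h * (√|1 - abs ξ| / 2)) 5 U G x ≤
        h / 2 * (5 * ‖U (-Real.arccos (-ξ) + 2 * Real.pi)‖ ^ 2) := by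
  rw [Real.arccos_neg]
  rcases le_or_gt ξ 1 with hle | hlt
  · have hs : 0 < √|1 - abs ξ| / 2 :=
      half_pos (Real.sqrt_pos.2 (abs_pos.2 (sub_ne_zero.2 hξ.symm)))
    have hend : -(Real.pi - Real.arccos ξ) + 2 * Real.pi = Real.pi + Real.arccos ξ := by ring
    rw [hend]
    refine hU.integral_coercivityDefect_le_of_le_neg_min (by fun_prop) hh hs
      (by linarith [Real.arccos_nonneg ξ]) fun x hx => ?_
    have hx' : |x - Real.pi| ≤ Real.arccos (- -ξ) := by
      rw [neg_neg]
      exact abs_le.2 ⟨by linarith [hx.1], by linarith [hx.2]⟩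
    have hbound := sqrt_mul_arccos_sub_abs_le (neg_le_neg hle) hx'
    rw [abs_neg, neg_neg, Real.cos_sub_pi] at hbound
    rw [min_eq_sub_abs]
    linarith
  · rw [Real.arccos_of_one_le hlt.le, show -(Real.pi - 0) + 2 * Real.pi = Real.pi - 0 by ring,
      intervalIntegral.integral_same]
    positivity

theorem rpow_half_mul_rpow_quarter {h d : ℝ} (hh : 0 ≤ h) (hd : 0 ≤ d) :
    h ^ (1 / 2 : ℝ) * d ^ (1 / 4 : ℝ) = √(h * √d) := by
  rw [Real.sqrt_mul hh, Real.sqrt_eq_rpow, Real.sqrt_eq_rpow, Real.sqrt_eq_rpow,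
    ← Real.rpow_mul hd]
  norm_num

theorem coerciveInCodim_one_PCirc {h ξ : ℝ} (hh : 0 < h) (hξ : |ξ| ≠ 1) :
    CoerciveInCodim (PCirc h ξ) (√(h * (√|1 - abs ξ| / 2)) / 5) 1 := by
  refine coerciveInCodim_PCirc (by norm_num) (-Real.arccos (-ξ)) (fun _ => -Real.arccos (-ξ))
    fun U G hU hper hzero => ?_
  have hleft := hU.integral_coercivityDefect_cos_le_left hh hξ
  have hright := hU.integral_coercivityDefect_cos_le_right hh hξ
  have hint := hU.intervalIntegrable_coercivityDefect (m := fun x => ξ + Real.cos x)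
    (by fun_prop) h √(h * (√|1 - abs ξ| / 2)) 5
  rw [hzero 0] at hleft
  rw [hper, hzero 0] at hright
  rw [← intervalIntegral.integral_add_adjacent_intervals (hint _ (Real.arccos (-ξ))) (hint _ _)]
  simp only [norm_zero] at hleft hright
  linarith

theorem exists_singularValues_PCirc {h : ℝ} (hh : 0 < h) (ξ : ℝ) :
    ∃ t : ℕ → ℝ, IsSingularValueSeq (PCirc h ξ) t ∧
      h ^ (1 / 2 : ℝ) * |1 - abs ξ| ^ (1 / 4 : ℝ) / 10 ≤ t 1 := by
  obtain ⟨t, ht⟩ := exists_isSingularValueSeq_PCirc hh ξ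
  refine ⟨t, ht, ?_⟩
  rcases eq_or_ne |ξ| 1 with hξ | hξ
  · simpa [hξ] using ht.nonneg 1
  have hle := ht.le_of_coerciveInCodim (dense_domain_PCirc h ξ) (coerciveInCodim_one_PCirc hh hξ)
  have hsqrt : √(h * √|1 - abs ξ|) / 2 ≤ √(h * (√|1 - abs ξ| / 2)) := by
    refine Real.le_sqrt_of_sq_le ?_
    rw [div_pow, Real.sq_sqrt (by positivity)]
    have : 0 ≤ h * √|1 - abs ξ| := by positivity
    linarith
  rw [rpow_half_mul_rpow_quarter hh.le (abs_nonneg _)]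
  linarith

/-! ### The operator on the line -/

section Elliptic

variable {U G : ℝ → ℂ} {m m' : ℝ → ℝ} {h C p q : ℝ}

theorem norm_sq_firstOrderFun (h : ℝ) (m : ℝ → ℝ) (U G : ℝ → ℂ) (x : ℝ) :
    ‖firstOrderFun h m U G x‖ ^ 2 = h ^ 2 * ‖G x‖ ^ 2 + m x ^ 2 * ‖U x‖ ^ 2 +
      2 * h * m x * (G x * starRingEnd ℂ (U x)).re := by
  simp only [firstOrderFun, ← Complex.normSq_eq_norm_sq, Complex.normSq_apply, Complex.add_re,
    Complex.add_im, Complex.mul_re, Complex.mul_im, Complex.ofReal_re, Complex.ofReal_im,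
    Complex.conj_re, Complex.conj_im]
  ring

theorem IsPrimitive.integral_sq_sub_norm_sq_le (hU : IsPrimitive U G)
    (hm : ∀ x, HasDerivAt m (m' x) x) (hm' : Continuous m') (hpq : p ≤ q)
    (hF : IntervalIntegrable (fun x => ‖firstOrderFun h m U G x‖ ^ 2) volume p q)
    (hC : ∀ x ∈ Icc p q, h * m' x ≤ m x ^ 2 / 2 + C) :
    ∫ x in p..q, (m x ^ 2 * ‖U x‖ ^ 2 / 2 - ‖firstOrderFun h m U G x‖ ^ 2 - C * ‖U x‖ ^ 2) ≤
      h * (m p * ‖U p‖ ^ 2 - m q * ‖U q‖ ^ 2) := by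
  have hUc := hU.continuous
  have hmc : Continuous m := continuous_iff_continuousAt.2 fun x => (hm x).continuousAt
  calc _ ≤ ∫ x in p..q, -h * (m' x * ‖U x‖ ^ 2 +
        2 * m x * (G x * starRingEnd ℂ (U x)).re) := by
        refine intervalIntegral.integral_mono_on hpq
          (((Continuous.intervalIntegrable (by fun_prop) p q).sub hF).sub
            (Continuous.intervalIntegrable (by fun_prop) p q))
          ((hU.intervalIntegrable_mul_norm_sq_add hmc hm' p q).const_mul (-h)) fun x hx => ?_
        have hG : 0 ≤ h ^ 2 * ‖G x‖ ^ 2 := by positivity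
        have hCU := mul_le_mul_of_nonneg_right (hC x hx) (sq_nonneg ‖U x‖)
        rw [norm_sq_firstOrderFun]
        linarith
    _ = _ := by
        rw [intervalIntegral.integral_const_mul, ← hU.mul_norm_sq_sub_eq hm hm']
        ring

end Elliptic

theorem hasPrimitives_line : HasPrimitives lineTests fun x : ℝ => x :=
  ⟨Measure.QuasiMeasurePreserving.id volume, fun _ _ h => h.exists_isPrimitive_line⟩

/-- The weight `(1 + y⁴)^{1/2}` in the domain of the operator on the line. -/
abbrev lineWeight (y : ℝ) : ℝ := Real.sqrt (1 + y ^ 4)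

/-- The truncations to `[-R, R]` need only be controlled by a boundary term that is integrable
in `R`. -/
theorem integral_nonpos_of_intervalIntegral_le {f g : ℝ → ℝ} (hf : Integrable f)
    (hg : Integrable g) {R₀ : ℝ} (hfg : ∀ R ≥ R₀, ∫ x in (-R)..R, f x ≤ g (-R)) :
    ∫ x, f x ≤ 0 := by
  by_contra! hpos
  have hlim := intervalIntegral_tendsto_integral hf tendsto_neg_atTop_atBot tendsto_id
  obtain ⟨R₁, hR₁⟩ := eventually_atTop.1 (hlim.eventually (lt_mem_nhds (half_lt_self hpos)))
  have hle : ∀ x ∈ Iic (-(max R₀ R₁)), (∫ x, f x) / 2 ≤ g x := by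
    intro x hx
    have hx' : max R₀ R₁ ≤ -x := le_neg_of_le_neg hx
    have hupper := hfg (-x) ((le_max_left _ _).trans hx')
    rw [neg_neg] at hupper
    have hlower := hR₁ (-x) ((le_max_right _ _).trans hx')
    rw [neg_neg] at hlower
    exact (hlower.trans_le hupper).le
  have hconst : IntegrableOn (fun _ : ℝ => (∫ x, f x) / 2) (Iic (-(max R₀ R₁))) := by
    refine Integrable.mono' hg.integrableOn aestronglyMeasurable_const ?_
    filter_upwards [ae_restrict_mem measurableSet_Iic] with x hx
    rw [Real.norm_of_nonneg (half_pos hpos).le]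
    exact hle x hx
  rw [integrableOn_const_iff, Real.volume_Iic] at hconst
  exact hconst.elim (enorm_ne_zero.2 (half_pos hpos).ne') (lt_irrefl _)

section Line

variable {h ξ κ N : ℝ}

theorem integrable_norm_sq_continuousRep_line (u : weightedH1 lineTests lineWeight) :
    Integrable fun x => ‖continuousRep hasPrimitives_line lineWeight u x‖ ^ 2 :=
  (integrable_norm_sq (u : Lp ℂ 2 (volume : Measure ℝ))).congr
    ((ae_eq_continuousRep hasPrimitives_line u).mono fun _ => congrArg (‖·‖ ^ 2))

theorem coerciveInCodim_PLine {B R₀ : ℝ} (hN : 0 < N) {n : ℕ} (a : Fin n → ℝ)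
    (hle : ∀ U G : ℝ → ℂ, IsPrimitive U G → (∀ i, U (a i) = 0) → ∀ R ≥ R₀,
      ∫ x in (-R)..R, coercivityDefect h (fun x => ξ + x ^ 2) κ N U G x ≤ B * ‖U (-R)‖ ^ 2) :
    CoerciveInCodim (PLine h ξ) (κ / N) n := by
  have hid : MeasurePreserving (fun x : ℝ => x) (volume.restrict univ) volume := by
    rw [Measure.restrict_univ]
    exact MeasurePreserving.id volume
  refine coerciveInCodim_firstOrderOp hasPrimitives_line hid hN a fun u hu => ?_
  have hdefect := integrableOn_coercivityDefect hasPrimitives_line hid (by fun_prop)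
    (line_bound ξ) h κ N u
  rw [integrableOn_univ] at hdefect
  rw [setIntegral_univ]
  exact integral_nonpos_of_intervalIntegral_le hdefect
    ((integrable_norm_sq_continuousRep_line u).const_mul B)
    (hle _ _ (isPrimitive_continuousRep hasPrimitives_line u) hu)

theorem dense_domain_PLine (h ξ : ℝ) :
    Dense ((PLine h ξ).domain : Set (Lp ℂ 2 (volume : Measure ℝ))) := by
  refine dense_weightedH1 (T := lineTests) (w := lineWeight) (fun p hp => ?_) fun p hp q hq =>
    (isPrimitive_of_mem_lineTests hp).integral_mul_of_mem_lineTests hq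
  have hcont : Continuous fun y : ℝ => (lineWeight y : ℂ) * p.1 y :=
    Continuous.mul (by fun_prop) hp.1.continuous
  exact hcont.memLp_of_hasCompactSupport hp.2.1.mul_left

theorem not_finiteDimensional_line : ¬ FiniteDimensional ℂ (Lp ℂ 2 (volume : Measure ℝ)) := by
  intro hfin
  let e (n : ℕ) : Lp ℂ 2 (volume : Measure ℝ) :=
    indicatorConstLp 2 (measurableSet_Ioc (a := (n : ℝ)) (b := n + 1)) (by simp) (1 : ℂ)
  have hne (n : ℕ) : e n ≠ 0 := by
    rw [← norm_ne_zero_iff, norm_indicatorConstLp two_ne_zero ENNReal.ofNat_ne_top]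
    simp
  have horth : Pairwise fun i j => inner ℂ (e i) (e j) = 0 := by
    intro i j hij
    refine (L2.inner_indicatorConstLp_one_indicatorConstLp_one measurableSet_Ioc
      measurableSet_Ioc (by simp) (by simp)).trans ?_
    have hdisj := pairwise_disjoint_Ioc_intCast ℝ (Nat.cast_injective.ne hij : (i : ℤ) ≠ j)
    simp only [Function.onFun, Int.cast_natCast] at hdisj
    simp [hdisj.inter_eq]
  have := (linearIndependent_of_ne_zero_of_inner_eq_zero hne horth).finite
  exact not_finite ℕ

theorem hasDerivAt_add_sq (ξ x : ℝ) : HasDerivAt (fun x => ξ + x ^ 2) (2 * x) x := by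
  simpa using (hasDerivAt_pow 2 x).const_add ξ

theorem two_mul_mul_le_sq_div_two_add (hh : 0 ≤ h) (ξ x : ℝ) :
    h * (2 * x) ≤ (ξ + x ^ 2) ^ 2 / 2 + (h * (1 + |ξ|) + h ^ 2 / 2) := by
  have hx : 2 * x ≤ 1 + |ξ| + (ξ + x ^ 2) := by nlinarith [sq_nonneg (x - 1), neg_abs_le ξ]
  have := mul_le_mul_of_nonneg_left hx hh
  linarith [sq_nonneg (h - (ξ + x ^ 2))]

/-- The product `(ξ + y²) u`, for `u` in the domain of the operator on the line. -/
def lineMul (ξ : ℝ) (u : weightedH1 lineTests lineWeight) : Lp ℂ 2 (volume : Measure ℝ) :=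
  (memLp_mul (m := fun y => ξ + y ^ 2) (by fun_prop) (line_bound ξ) u).toLp

theorem norm_lineMul_ae_eq (ξ : ℝ) (u : weightedH1 lineTests lineWeight) :
    ∀ᵐ x, ‖lineMul ξ u x‖ = |ξ + x ^ 2| * ‖(u : Lp ℂ 2 (volume : Measure ℝ)) x‖ :=
  (memLp_mul (m := fun y => ξ + y ^ 2) (by fun_prop) (line_bound ξ) u).coeFn_toLp.mono
    fun x hx => by rw [lineMul, hx, norm_mul, Complex.norm_real, Real.norm_eq_abs]

theorem integrable_mul_norm_sq_continuousRep_line (ξ : ℝ) (u : weightedH1 lineTests lineWeight) :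
    Integrable fun x => (ξ + x ^ 2) * ‖continuousRep hasPrimitives_line lineWeight u x‖ ^ 2 := by
  have hcont := (isPrimitive_continuousRep hasPrimitives_line u).continuous
  refine (integrable_norm_mul_norm (lineMul ξ u) u).mono'
    (by fun_prop : Continuous _).aestronglyMeasurable ?_
  filter_upwards [norm_lineMul_ae_eq ξ u, ae_eq_continuousRep hasPrimitives_line u] with x hmul hu
  rw [hmul, hu, norm_mul, norm_pow, norm_norm, Real.norm_eq_abs, mul_assoc, pow_two ‖_‖]

theorem PLine_ae_eq (u : (PLine h ξ).domain) : ∀ᵐ x, PLine h ξ u x =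
    firstOrderFun h (fun x => ξ + x ^ 2)
      (continuousRep hasPrimitives_line lineWeight u)
      (weakDeriv (T := lineTests) (w := lineWeight) u) x :=
  firstOrderOp_ae_eq hasPrimitives_line (w := lineWeight) u

theorem integral_norm_sq_sub_norm_sq_nonpos (hh : 0 ≤ h) (u : (PLine h ξ).domain) :
    ∫ x, (‖lineMul ξ u x‖ ^ 2 / 2 -
      ‖PLine h ξ u x‖ ^ 2 -
        (h * (1 + |ξ|) + h ^ 2 / 2) * ‖(u : Lp ℂ 2 (volume : Measure ℝ)) x‖ ^ 2) ≤ 0 := by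
  have hU := isPrimitive_continuousRep hasPrimitives_line (w := lineWeight) u
  set U := continuousRep hasPrimitives_line lineWeight u
  set F := firstOrderFun h (fun x => ξ + x ^ 2) U
    (weakDeriv (T := lineTests) (w := lineWeight) u)
  have hae : ∀ᵐ x, ‖lineMul ξ u x‖ ^ 2 / 2 - ‖PLine h ξ u x‖ ^ 2 -
      (h * (1 + |ξ|) + h ^ 2 / 2) * ‖(u : Lp ℂ 2 (volume : Measure ℝ)) x‖ ^ 2 =
        (ξ + x ^ 2) ^ 2 * ‖U x‖ ^ 2 / 2 - ‖F x‖ ^ 2 -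
          (h * (1 + |ξ|) + h ^ 2 / 2) * ‖U x‖ ^ 2 := by
    filter_upwards [norm_lineMul_ae_eq ξ u, PLine_ae_eq u,
      ae_eq_continuousRep hasPrimitives_line (w := lineWeight) u] with x hmul hop hu
    rw [hmul, hop, hu, mul_pow, sq_abs]
  have hint := (((integrable_norm_sq (lineMul ξ u)).div_const 2).sub
    (integrable_norm_sq (PLine h ξ u))).sub
      ((integrable_norm_sq (u : Lp ℂ 2 (volume : Measure ℝ))).const_mul
        (h * (1 + |ξ|) + h ^ 2 / 2))
  have hF : Integrable fun x => ‖F x‖ ^ 2 :=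
    (integrable_norm_sq (PLine h ξ u)).congr ((PLine_ae_eq u).mono fun _ => congrArg (‖·‖ ^ 2))
  rw [integral_congr_ae hae]
  refine integral_nonpos_of_intervalIntegral_le (R₀ := 1 + |ξ|) (hint.congr hae)
    ((integrable_mul_norm_sq_continuousRep_line ξ u).const_mul h) fun R hR => ?_
  have hR1 : 1 ≤ R := by linarith [abs_nonneg ξ]
  have hmR : 0 ≤ ξ + R ^ 2 := by nlinarith [neg_abs_le ξ]
  have hboundary : 0 ≤ h * ((ξ + R ^ 2) * ‖U R‖ ^ 2) := by positivity
  have := hU.integral_sq_sub_norm_sq_le (hasDerivAt_add_sq ξ) (by fun_prop)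
    (by linarith : -R ≤ R) hF.intervalIntegrable fun x _ => two_mul_mul_le_sq_div_two_add hh ξ x
  linarith

theorem norm_sq_lineMul_le (hh : 0 ≤ h) (u : (PLine h ξ).domain) :
    ‖lineMul ξ u‖ ^ 2 ≤
      2 * (‖PLine h ξ u‖ ^ 2 + (h * (1 + |ξ|) + h ^ 2 / 2) *
        ‖(u : Lp ℂ 2 (volume : Measure ℝ))‖ ^ 2) := by
  have hle := integral_norm_sq_sub_norm_sq_nonpos hh u
  have hdiff : Integrable fun x => ‖lineMul ξ u x‖ ^ 2 / 2 - ‖PLine h ξ u x‖ ^ 2 :=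
    ((integrable_norm_sq _).div_const 2).sub (integrable_norm_sq _)
  rw [integral_sub hdiff ((integrable_norm_sq _).const_mul _),
    integral_sub ((integrable_norm_sq _).div_const 2) (integrable_norm_sq _), integral_div,
    integral_const_mul, ← norm_sq_eq_integral, ← norm_sq_eq_integral, ← norm_sq_eq_integral] at hle
  linarith

theorem norm_sq_lineWeight_mul_le (u : weightedH1 lineTests lineWeight) (ξ : ℝ) :
    ‖u.2.1.toLp‖ ^ 2 ≤ (1 + 2 * ξ ^ 2) * ‖(u : Lp ℂ 2 (volume : Measure ℝ))‖ ^ 2 +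
      2 * ‖lineMul ξ u‖ ^ 2 := by
  rw [norm_sq_eq_integral, norm_sq_eq_integral, norm_sq_eq_integral, ← integral_const_mul,
    ← integral_const_mul, ← integral_add ((integrable_norm_sq _).const_mul _)
      ((integrable_norm_sq _).const_mul _)]
  refine integral_mono_ae (integrable_norm_sq _)
    (((integrable_norm_sq _).const_mul _).add ((integrable_norm_sq _).const_mul _)) ?_
  filter_upwards [u.2.1.coeFn_toLp, norm_lineMul_ae_eq ξ u] with x hwu hmul
  have hweight : 1 + x ^ 4 ≤ 1 + 2 * ξ ^ 2 + 2 * (ξ + x ^ 2) ^ 2 := by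
    nlinarith [sq_nonneg (2 * ξ + x ^ 2)]
  rw [hwu, hmul, norm_mul, Complex.norm_real, Real.norm_eq_abs, mul_pow, mul_pow, sq_abs, sq_abs,
    Real.sq_sqrt (by positivity)]
  have := mul_le_mul_of_nonneg_right hweight (sq_nonneg ‖(u : Lp ℂ 2 (volume : Measure ℝ)) x‖)
  linarith

theorem isClosed_PLine (hh : 0 < h) (ξ : ℝ) : (PLine h ξ).IsClosed := by
  refine isClosed_firstOrderOp (C := 5 + 2 * ξ ^ 2 + 4 * (h * (1 + |ξ|) + h ^ 2 / 2))
    (by fun_prop) hh.ne' (fun p hp => ?_) fun u => ?_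
  · have hcont : Continuous fun y : ℝ => ((ξ + y ^ 2 : ℝ) : ℂ) * p.1 y :=
      Continuous.mul (by fun_prop) hp.1.continuous
    exact hcont.memLp_of_hasCompactSupport hp.2.1.mul_left
  · change _ ≤ _ * (‖(u : Lp ℂ 2 (volume : Measure ℝ))‖ ^ 2 + ‖PLine h ξ u‖ ^ 2)
    have hweight := norm_sq_lineWeight_mul_le u ξ
    have hmul := norm_sq_lineMul_le hh.le (ξ := ξ) u
    have hu : 0 ≤ 4 * ‖(u : Lp ℂ 2 (volume : Measure ℝ))‖ ^ 2 := by positivity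
    have hPu : 0 ≤ (1 + 2 * ξ ^ 2 + 4 * (h * (1 + |ξ|) + h ^ 2 / 2)) * ‖PLine h ξ u‖ ^ 2 := by
      positivity
    linarith

theorem exists_coerciveInCodim_PLine (hh : 0 < h) (ξ κ : ℝ) :
    ∃ n, CoerciveInCodim (PLine h ξ) κ n := by
  have hm : Continuous fun x : ℝ => ξ + x ^ 2 := by fun_prop
  set R₀ := 1 + |κ * 3| + |ξ|
  have hR₀ : 1 ≤ R₀ := by linarith [abs_nonneg (κ * 3), abs_nonneg ξ]
  have hlarge (x : ℝ) (hx : R₀ ≤ |x|) : κ * 3 ≤ ξ + x ^ 2 := by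
    rw [← sq_abs x]
    nlinarith [neg_abs_le ξ, le_abs_self (κ * 3)]
  obtain ⟨n, a, ha⟩ := exists_integral_coercivityDefect_nonpos hm hh (κ * 3)
    (p := -R₀) (q := R₀) (by linarith)
  refine ⟨n + 1, ?_⟩
  rw [← mul_div_cancel_right₀ κ (three_ne_zero (α := ℝ))]
  refine coerciveInCodim_PLine (R₀ := R₀) (B := h / 2) three_pos (Fin.cons R₀ a)
    fun U G hU hzero R hR => ?_
  have hR₀0 : U R₀ = 0 := hzero 0
  have hint := hU.intervalIntegrable_coercivityDefect hm h (κ * 3)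
  have htail {p q : ℝ} (hpq : p ≤ q) (hx : ∀ x ∈ Icc p q, R₀ ≤ |x|) :=
    (intervalIntegral.integral_mono_on hpq (hint 3 p q) (hint 1 p q) fun x _ =>
      coercivityDefect_anti (by norm_num) x).trans
        (hU.integral_coercivityDefect_le_of_le hm hh.le hpq fun x hxI => hlarge x (hx x hxI))
  have hleft := htail (p := -R) (q := -R₀) (by linarith) fun x hx =>
    le_abs.2 (.inr (by linarith [hx.2]))
  have hmiddle := ha U G hU fun i => hzero i.succ
  have hright := htail hR fun x hx => le_abs.2 (.inl hx.1)
  rw [hR₀0, norm_zero] at hright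
  rw [← intervalIntegral.integral_add_adjacent_intervals (hint 3 (-R) (-R₀)) (hint 3 _ R),
    ← intervalIntegral.integral_add_adjacent_intervals (hint 3 (-R₀) R₀) (hint 3 _ R)]
  linarith

theorem exists_isSingularValueSeq_PLine (hh : 0 < h) (ξ : ℝ) :
    ∃ t : ℕ → ℝ, IsSingularValueSeq (PLine h ξ) t :=
  exists_isSingularValueSeq not_finiteDimensional_line (dense_domain_PLine h ξ)
    (isClosed_PLine hh ξ) (exists_coerciveInCodim_PLine hh ξ)

theorem sqrt_abs_mul_le_add_sq {x : ℝ} (hx : √(-ξ) ≤ |x|) :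
    √|ξ| * (|x| - √(-ξ)) ≤ ξ + x ^ 2 := by
  rw [← sq_abs x]
  rcases le_total 0 ξ with hξ | hξ
  · rw [Real.sqrt_eq_zero_of_nonpos (neg_nonpos.2 hξ), abs_of_nonneg hξ]
    nlinarith [Real.sq_sqrt hξ, sq_nonneg (√ξ - |x|)]
  · rw [abs_of_nonpos hξ]
    nlinarith [Real.sq_sqrt (neg_nonneg.2 hξ), Real.sqrt_nonneg (-ξ)]

theorem add_sq_le_neg_sqrt_abs_mul (hξ : ξ ≤ 0) {x : ℝ} (hx : |x| ≤ √(-ξ)) :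
    ξ + x ^ 2 ≤ -(√|ξ| * (√(-ξ) - |x|)) := by
  rw [abs_of_nonpos hξ, ← sq_abs x]
  nlinarith [Real.sq_sqrt (neg_nonneg.2 hξ), abs_nonneg x]

variable {U G : ℝ → ℂ}

theorem IsPrimitive.integral_coercivityDefect_add_sq_le_left (hU : IsPrimitive U G) (hh : 0 < h)
    (hξ : ξ ≠ 0) {R : ℝ} (hR : √(-ξ) ≤ R) :
    ∫ x in (-R)..-√(-ξ), coercivityDefect h (fun x => ξ + x ^ 2) √(h * √|ξ|) 5 U G x ≤
      h / 2 * (5 * ‖U (-R)‖ ^ 2) := by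
  refine hU.integral_coercivityDefect_le_of_min_le (by fun_prop) hh
    (Real.sqrt_pos.2 (abs_pos.2 hξ)) (neg_le_neg hR) fun x hx => ?_
  have habs : |x| = -x := abs_of_nonpos (hx.2.trans (neg_nonpos.2 (Real.sqrt_nonneg _)))
  refine le_trans ?_ (sqrt_abs_mul_le_add_sq (by linarith [hx.2]))
  rw [habs, show -x - √(-ξ) = -√(-ξ) - x by ring]
  gcongr
  exact min_le_right _ _

theorem IsPrimitive.integral_coercivityDefect_add_sq_le_right (hU : IsPrimitive U G) (hh : 0 < h)
    (hξ : ξ ≠ 0) {R : ℝ} (hR : √(-ξ) ≤ R) :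
    ∫ x in √(-ξ)..R, coercivityDefect h (fun x => ξ + x ^ 2) √(h * √|ξ|) 5 U G x ≤
      h / 2 * (5 * ‖U √(-ξ)‖ ^ 2) := by
  refine hU.integral_coercivityDefect_le_of_min_le (by fun_prop) hh
    (Real.sqrt_pos.2 (abs_pos.2 hξ)) hR fun x hx => ?_
  have habs : |x| = x := abs_of_nonneg ((Real.sqrt_nonneg _).trans hx.1)
  refine le_trans ?_ (sqrt_abs_mul_le_add_sq (by linarith [hx.1]))
  rw [habs]
  gcongr
  exact min_le_left _ _

theorem IsPrimitive.integral_coercivityDefect_add_sq_le_middle (hU : IsPrimitive U G)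
    (hh : 0 < h) (hξ : ξ ≠ 0) :
    ∫ x in -√(-ξ)..√(-ξ), coercivityDefect h (fun x => ξ + x ^ 2) √(h * √|ξ|) 5 U G x ≤
      h / 2 * (5 * ‖U √(-ξ)‖ ^ 2) := by
  rcases hξ.lt_or_gt with hneg | hpos
  · refine hU.integral_coercivityDefect_le_of_le_neg_min (by fun_prop) hh
      (Real.sqrt_pos.2 (abs_pos.2 hξ)) (neg_le_self (Real.sqrt_nonneg _)) fun x hx => ?_
    have hmin := min_eq_sub_abs x 0 √(-ξ)
    rw [zero_sub, zero_add, sub_zero] at hmin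
    rw [hmin]
    exact add_sq_le_neg_sqrt_abs_mul hneg.le (abs_le.2 hx)
  · rw [Real.sqrt_eq_zero_of_nonpos (neg_nonpos.2 hpos.le), neg_zero,
      intervalIntegral.integral_same]
    positivity

theorem coerciveInCodim_one_PLine (hh : 0 < h) (hξ : ξ ≠ 0) :
    CoerciveInCodim (PLine h ξ) (√(h * √|ξ|) / 5) 1 := by
  refine coerciveInCodim_PLine (R₀ := √(-ξ)) (B := h / 2 * 5) (by norm_num) (fun _ => √(-ξ))
    fun U G hU hzero R hR => ?_
  have hleft := hU.integral_coercivityDefect_add_sq_le_left hh hξ hR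
  have hmiddle := hU.integral_coercivityDefect_add_sq_le_middle hh hξ
  have hright := hU.integral_coercivityDefect_add_sq_le_right hh hξ hR
  have hint := hU.intervalIntegrable_coercivityDefect (m := fun x => ξ + x ^ 2) (by fun_prop) h
    √(h * √|ξ|) 5
  rw [hzero 0, norm_zero] at hmiddle hright
  rw [← intervalIntegral.integral_add_adjacent_intervals (hint (-R) (-√(-ξ))) (hint _ R),
    ← intervalIntegral.integral_add_adjacent_intervals (hint (-√(-ξ)) √(-ξ)) (hint _ R)]
  linarith

theorem exists_singularValues_PLine (hh : 0 < h) (ξ : ℝ) :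
    ∃ t : ℕ → ℝ, IsSingularValueSeq (PLine h ξ) t ∧
      h ^ (1 / 2 : ℝ) * |ξ| ^ (1 / 4 : ℝ) / 5 ≤ t 1 := by
  obtain ⟨t, ht⟩ := exists_isSingularValueSeq_PLine hh ξ
  refine ⟨t, ht, ?_⟩
  rcases eq_or_ne ξ 0 with rfl | hξ
  · simpa using ht.nonneg 1
  · rw [rpow_half_mul_rpow_quarter hh.le (abs_nonneg ξ)]
    exact ht.le_of_coerciveInCodim (dense_domain_PLine h ξ) (coerciveInCodim_one_PLine hh hξ)

end Line

/-! ### Uniformity on compact sets -/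

theorem exists_uniform_lower_bound_of_isCompact {H : Type*} [NormedAddCommGroup H]
    [InnerProductSpace ℂ H] [CompleteSpace H] {A : ℝ → ℝ → (H →ₗ.[ℂ] H)} {d : ℝ → ℝ} {N : ℝ}
    (hN : 0 < N) (hA : ∀ h > 0, ∀ ξ, ∃ t : ℕ → ℝ, IsSingularValueSeq (A h ξ) t ∧
      h ^ (1 / 2 : ℝ) * |d ξ| ^ (1 / 4 : ℝ) / N ≤ t 1)
    {K : Set ℝ} (hK : IsCompact K) (hd : ContinuousOn d K) (hd0 : ∀ ξ ∈ K, d ξ ≠ 0) :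
    ∃ C : ℝ, 0 < C ∧ ∃ h₀ : ℝ, 0 < h₀ ∧ ∀ h ∈ Ioc 0 h₀, ∀ ξ ∈ K,
      ∃ t : ℕ → ℝ, IsSingularValueSeq (A h ξ) t ∧ h ^ (1 / 2 : ℝ) / C ≤ t 1 := by
  obtain ⟨c, hc, hle⟩ := hK.exists_forall_le' (f := fun ξ => |d ξ| ^ (1 / 4 : ℝ))
    (hd.abs.rpow_const fun _ _ => .inr (by norm_num)) (a := 0)
    fun ξ hξ => Real.rpow_pos_of_pos (abs_pos.2 (hd0 ξ hξ)) _
  refine ⟨N / c, div_pos hN hc, 1, one_pos, fun h hh ξ hξ => ?_⟩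
  obtain ⟨t, ht, hbound⟩ := hA h hh.1 ξ
  refine ⟨t, ht, le_trans ?_ hbound⟩
  have := Real.rpow_nonneg hh.1.le (1 / 2 : ℝ)
  rw [div_div_eq_mul_div]
  gcongr
  exact hle ξ hξ

end SmallSV

end

theorem theorem2p5_general {h : ℝ} (hh : 0 < h) (ξ : ℝ) :
    (∃ t : ℕ → ℝ, SmallSV.IsSingularValueSeq (SmallSV.PLine h ξ) t ∧
      h ^ (1 / 2 : ℝ) * |ξ| ^ (1 / 4 : ℝ) / 5 ≤ t 1) ∧
    ∃ t : ℕ → ℝ, SmallSV.IsSingularValueSeq (SmallSV.PCirc h ξ) t ∧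
      h ^ (1 / 2 : ℝ) * |1 - abs ξ| ^ (1 / 4 : ℝ) / 10 ≤ t 1 :=
  ⟨SmallSV.exists_singularValues_PLine hh ξ, SmallSV.exists_singularValues_PCirc hh ξ⟩

theorem theorem2p5 :
    -- `Y = ℝ`, `ξ` in a compact subset of `]-∞, 0[`
    (∀ K : Set ℝ, IsCompact K → K ⊆ Set.Iio 0 →
      ∃ C : ℝ, 0 < C ∧ ∃ h₀ : ℝ, 0 < h₀ ∧ ∀ h ∈ Set.Ioc 0 h₀, ∀ ξ ∈ K,
        ∃ t : ℕ → ℝ, SmallSV.IsSingularValueSeq (SmallSV.PLine h ξ) t ∧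
          h ^ (1 / 2 : ℝ) / C ≤ t 1) ∧
    -- `Y = S¹`, `ξ` in a compact subset of `]-1, 1[`
    (∀ K : Set ℝ, IsCompact K → K ⊆ Set.Ioo (-1) 1 →
      ∃ C : ℝ, 0 < C ∧ ∃ h₀ : ℝ, 0 < h₀ ∧ ∀ h ∈ Set.Ioc 0 h₀, ∀ ξ ∈ K,
        ∃ t : ℕ → ℝ, SmallSV.IsSingularValueSeq (SmallSV.PCirc h ξ) t ∧
          h ^ (1 / 2 : ℝ) / C ≤ t 1) ∧
    -- `Y = ℝ`, degenerate range and large negative `ξ`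
    (∀ C₀ : ℝ, 0 < C₀ →
      ∃ C : ℝ, 0 < C ∧ ∃ h₀ : ℝ, 0 < h₀ ∧ ∀ h ∈ Set.Ioc 0 h₀, ∀ ξ : ℝ,
        ((C₀ * h ^ (2 / 3 : ℝ) ≤ -ξ ∧ -ξ ≤ 1 / C₀) ∨ C₀ ≤ -ξ) →
        ∃ t : ℕ → ℝ, SmallSV.IsSingularValueSeq (SmallSV.PLine h ξ) t ∧
          h ^ (1 / 2 : ℝ) * |ξ| ^ (1 / 4 : ℝ) / C ≤ t 1) ∧
    -- `Y = S¹`, degenerate ranges near `ξ = -1` and `ξ = 1`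
    (∀ C₀ : ℝ, 0 < C₀ →
      ∃ C : ℝ, 0 < C ∧ ∃ h₀ : ℝ, 0 < h₀ ∧ ∀ h ∈ Set.Ioc 0 h₀, ∀ ξ : ℝ,
        ((C₀ * h ^ (2 / 3 : ℝ) ≤ 1 + ξ ∧ 1 + ξ ≤ 1 / C₀) ∨
          (C₀ * h ^ (2 / 3 : ℝ) ≤ 1 - ξ ∧ 1 - ξ ≤ 1 / C₀)) →
        ∃ t : ℕ → ℝ, SmallSV.IsSingularValueSeq (SmallSV.PCirc h ξ) t ∧
          h ^ (1 / 2 : ℝ) * |1 - abs ξ| ^ (1 / 4 : ℝ) / C ≤ t 1) := by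
  refine ⟨fun K hK hKs => ?_, fun K hK hKs => ?_,
    fun _ _ => ⟨5, by norm_num, 1, one_pos, fun h hh ξ _ => (theorem2p5_general hh.1 ξ).1⟩,
    fun _ _ => ⟨10, by norm_num, 1, one_pos, fun h hh ξ _ => (theorem2p5_general hh.1 ξ).2⟩⟩
  · exact SmallSV.exists_uniform_lower_bound_of_isCompact (by norm_num)
      (fun h hh ξ => (theorem2p5_general hh ξ).1) hK continuousOn_id fun ξ hξ => (hKs hξ).ne
  · exact SmallSV.exists_uniform_lower_bound_of_isCompact (d := fun ξ => 1 - abs ξ) (by norm_num)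
      (fun h hh ξ => (theorem2p5_general hh ξ).2) hK (by fun_prop)
      fun ξ hξ => sub_ne_zero.2 (abs_lt.2 (hKs hξ)).ne'
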